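/- **Theorem (canonical divergence).** Let $(\mathcal M,g,\nabla,\nabla^*)$ be a statistical manifold of dimension $d\ge 2$: $g$ is a Riemannian metric and $\nabla,\nabla^*$ are smooth torsion-free affine connections with $Z\langle X,Y\rangle=\langle\nabla_ZX,Y\rangle+\langle X,\nabla^*_ZY\rangle$. Let $\alpha>0$. Suppose that $\nabla$ and $\nabla^*$ are projectively flat (each equals $\widetilde\nabla_XY+\tau(X)Y+\tau(Y)X$ for some flat torsion-free connection $\widetilde\nabla$ and some smooth $1$-form $\tau$) and that both have constant sectional curvature $k$, where $k=-\alpha$ or $k=+\alpha$, that is, $R(X,Y)Z=k(\langle Y,Z\rangle X-\langle X,Z\rangle Y)$ for their curvature tensors. Consider local coordinate systems $\xi,\eta$ on a common open set $U\subset\mathcal M$ and smooth functions $\varphi(\xi)$, $\psi(\eta)$ such that 1. the $\nabla$-geodesics are straight lines in the coordinates $\xi$, and the $\nabla^*$-geodesics are straight lines in the coordinates $\eta$, up to time reparameterization; 2. $1+\alpha\,\xi\cdot\eta>0$ on $U$; 3. $\varphi(\xi)+\psi(\eta)=\frac1\alpha\log(1+\alpha\,\xi\cdot\eta)$ on $U$,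 and $e^{\alpha\varphi}$, $e^{\alpha\psi}$ are locally concave if $k=-\alpha$, locally convex if $k=+\alpha$; 4. in the coordinates $\xi$, $g_{ij}=\mp\left(\partial_i\partial_j\varphi+\alpha\,\partial_i\varphi\,\partial_j\varphi\right)$, and in the coordinates $\eta$, $g_{ij}=\mp\left(\partial_i\partial_j\psi+\alpha\,\partial_i\psi\,\partial_j\psi\right)$, with sign $-$ if $k=-\alpha$ and $+$ if $k=+\alpha$; 5. $\eta$ is the $\alpha$-gradient of $\varphi$: $1-\alpha\,D\varphi(\xi)\cdot\xi>0$ and $\eta=\dfrac{D\varphi(\xi)}{1-\alpha\,D\varphi(\xi)\cdot\xi}$ on $U$. For $q,p\in U$ with $1+\alpha\,\xi_q\cdot\eta_p>0$ (call such a pair admissible) define $$\mathbf D[q:p]=\tfrac1\alpha\log(1+\alpha\,\xi_q\cdot\eta_p)-\varphi(\xi_q)-\psi(\eta_p)\quad\text{if }k=-\alpha,$$ $$\mathbf D[q:p]=\varphi(\xi_q)+\psi(\eta_p)-\tfrac1\alpha\log(1+\alpha\,\xi_q\cdot\eta_p)\quad\text{if }k=+\alpha.$$ (a) *Independence.* If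 $(\xi,\eta,\varphi,\psi)$ on $U$ and $(\xi',\eta',\varphi',\psi')$ on $U'$ are two such choices and $W\subset U\cap U'$ is open and connected, then for all $q,p\in W$ the pair $(q,p)$ is admissible for one choice if and only if it is admissible for the other, and in that case the two values of $\mathbf D[q:p]$ agree. (b) *Induced geometry.* All pairs near the diagonal of $U\times U$ are admissible, and near the diagonal $\mathbf D$ is smooth, nonnegative, and zero exactly on the diagonal. It induces $g$, $\nabla$ and $\nabla^*$ on $U$: in every local coordinate system, with $x$ the coordinates of the first argument and $y$ those of the second, one has on the diagonal $x=y$ $$g_{ij}=-\partial_{x^i}\partial_{y^j}\mathbf D,\qquad \langle\nabla_{\partial_i}\partial_j,\partial_k\rangle=-\partial_{x^i}\partial_{x^j}\partial_{y^k}\mathbf D,\qquad \langle\nabla^*_{\partial_i}\partial_j,\partial_k\rangle=-\partial_{y^i}\partial_{y^j}\partial_{x^k}\mathbf D .$$ -/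

import Mathlib

open scoped Manifold ContDiff Topology Bundle

/-- The model space `ℝᵈ`. -/
abbrev E (d : ℕ) : Type := EuclideanSpace ℝ (Fin d)

/-- The `i`-th partial derivative of a function on `ℝᵈ`. -/
noncomputable def partialDeriv {d : ℕ} (i : Fin d) (f : E d → ℝ) (x : E d) : ℝ :=
  fderiv ℝ f x (EuclideanSpace.single i 1)

section Connections

variable {d : ℕ} {M : Type*} [TopologicalSpace M] [ChartedSpace (E d) M] [IsManifold (𝓡 d) ∞ M]

/-- `X` is a smooth vector field on the set `U`. Values outside `U` are irrelevant. -/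
def SmoothFieldOn (X : ∀ x : M, TangentSpace (𝓡 d) x) (U : Set M) : Prop :=
  ContMDiffOn (𝓡 d) (𝓡 d).tangent ∞ (fun x => (⟨x, X x⟩ : TangentBundle (𝓡 d) M)) U

/-- Affine connections on `M`: covariant derivatives on the tangent bundle.
The vector `∇_X Y` at `x` is written `cov Y x (X x)`. -/
abbrev AffineConnection (d : ℕ) (M : Type*) [TopologicalSpace M] [ChartedSpace (E d) M]
    [IsManifold (𝓡 d) ∞ M] :=
  CovariantDerivative (𝓡 d) (E d) (fun x : M => TangentSpace (𝓡 d) x)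

/-- A connection is smooth if `∇_X Y` is smooth on an open set where `X` and `Y` are. -/
def SmoothConnection (cov : AffineConnection d M) : Prop :=
  ∀ U : Set M, IsOpen U → ∀ X Y : ∀ x : M, TangentSpace (𝓡 d) x,
    SmoothFieldOn X U → SmoothFieldOn Y U → SmoothFieldOn (fun x => cov Y x (X x)) U

/-- `R(X, Y) Z = ∇_X ∇_Y Z - ∇_Y ∇_X Z - ∇_[X, Y] Z`. -/
noncomputable def curvature (cov : AffineConnection d M) (X Y Z : ∀ x : M, TangentSpace (𝓡 d) x)
    (x : M) : TangentSpace (𝓡 d) x :=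
  cov (fun y => cov Z y (Y y)) x (X x) - cov (fun y => cov Z y (X y)) x (Y x)
    - cov Z x (VectorField.mlieBracket (𝓡 d) X Y x)

/-- A connection is flat if its curvature tensor vanishes. -/
def IsFlatConnection (cov : AffineConnection d M) : Prop :=
  ∀ U : Set M, IsOpen U → ∀ X Y Z : ∀ x : M, TangentSpace (𝓡 d) x,
    SmoothFieldOn X U → SmoothFieldOn Y U → SmoothFieldOn Z U →
      ∀ x ∈ U, curvature cov X Y Z x = 0

/-- Smooth differential `1`-forms. -/
def SmoothOneForm (τ : ∀ x : M, TangentSpace (𝓡 d) x →L[ℝ] ℝ) : Prop :=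
  ∀ U : Set M, IsOpen U → ∀ X : ∀ x : M, TangentSpace (𝓡 d) x, SmoothFieldOn X U →
    ContMDiffOn (𝓡 d) 𝓘(ℝ, ℝ) ∞ (fun x => τ x (X x)) U

/-- `∇_X Y = ∇'_X Y + τ(X) Y + τ(Y) X` for some smooth `1`-form `τ`. -/
def ProjectivelyEquivalent (cov cov' : AffineConnection d M) : Prop :=
  ∃ τ : ∀ x : M, TangentSpace (𝓡 d) x →L[ℝ] ℝ, SmoothOneForm τ ∧
    ∀ U : Set M, IsOpen U → ∀ X Y : ∀ x : M, TangentSpace (𝓡 d) x,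
      SmoothFieldOn X U → SmoothFieldOn Y U → ∀ x ∈ U,
        cov Y x (X x) = cov' Y x (X x) + τ x (X x) • Y x + τ x (Y x) • X x

/-- A connection is projectively flat if it is projectively equivalent to a flat torsion-free
connection. -/
def ProjectivelyFlat (cov : AffineConnection d M) : Prop :=
  ∃ cov' : AffineConnection d M, SmoothConnection cov' ∧ cov'.torsion = 0 ∧
    IsFlatConnection cov' ∧ ProjectivelyEquivalent cov cov'

/-- Smooth Riemannian metrics on `M`. -/
abbrev RMetric (d : ℕ) (M : Type*) [TopologicalSpace M] [ChartedSpace (E d) M]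
    [IsManifold (𝓡 d) ∞ M] :=
  Bundle.ContMDiffRiemannianMetric (𝓡 d) ∞ (E d) (fun x : M => TangentSpace (𝓡 d) x)

/-- `R(X, Y) Z = k (⟨Y, Z⟩ X - ⟨X, Z⟩ Y)`. -/
def HasConstantSectionalCurvature (g : RMetric d M) (cov : AffineConnection d M) (k : ℝ) : Prop :=
  ∀ U : Set M, IsOpen U → ∀ X Y Z : ∀ x : M, TangentSpace (𝓡 d) x,
    SmoothFieldOn X U → SmoothFieldOn Y U → SmoothFieldOn Z U → ∀ x ∈ U,
      curvature cov X Y Z x = k • (g.inner x (Y x) (Z x) • X x - g.inner x (X x) (Z x) • Y x)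

end Connections

/-- A dualistic structure `(g, ∇, ∇*)` on `M`, making `M` a statistical manifold. -/
structure DualisticStructure (d : ℕ) (M : Type*) [TopologicalSpace M] [ChartedSpace (E d) M]
    [IsManifold (𝓡 d) ∞ M] where
  /-- the Riemannian metric -/
  g : RMetric d M
  /-- the primal connection -/
  primal : AffineConnection d M
  /-- the dual connection -/
  dual : AffineConnection d M
  smooth_primal : SmoothConnection primal
  smooth_dual : SmoothConnection dual
  torsion_primal : primal.torsion = 0
  torsion_dual : dual.torsion = 0
  /-- `Z ⟨X, Y⟩ = ⟨∇_Z X, Y⟩ + ⟨X, ∇*_Z Y⟩` -/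
  duality : ∀ U : Set M, IsOpen U → ∀ X Y Z : ∀ x : M, TangentSpace (𝓡 d) x,
    SmoothFieldOn X U → SmoothFieldOn Y U → SmoothFieldOn Z U → ∀ x ∈ U,
      mvfderiv (𝓡 d) (fun y => g.inner y (X y) (Y y)) x (Z x) =
        g.inner x (primal X x (Z x)) (Y x) + g.inner x (X x) (dual Y x (Z x))

section Coordinates

variable {d : ℕ} {M : Type*} [TopologicalSpace M] [ChartedSpace (E d) M] [IsManifold (𝓡 d) ∞ M]

/-- The coordinate vector field `∂/∂χⁱ` of a local coordinate system `χ`. -/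
noncomputable def coordField (χ : OpenPartialHomeomorph M (E d)) (i : Fin d) :
    ∀ x : M, TangentSpace (𝓡 d) x :=
  VectorField.mpullback (𝓡 d) 𝓘(ℝ, E d) χ
    (fun y => (NormedSpace.fromTangentSpace y).symm (EuclideanSpace.single i 1))

/-- The coefficients `g_ij` of the metric in the coordinates `χ`. -/
noncomputable def metricCoeff (g : RMetric d M) (χ : OpenPartialHomeomorph M (E d)) (i j : Fin d)
    (p : M) : ℝ :=
  g.inner p (coordField χ i p) (coordField χ j p)

/-- `Γ_ijk = ⟨∇_{∂_i} ∂_j, ∂_k⟩` in the coordinates `χ`. -/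
noncomputable def christoffelLower (g : RMetric d M) (cov : AffineConnection d M)
    (χ : OpenPartialHomeomorph M (E d)) (i j k : Fin d) (p : M) : ℝ :=
  g.inner p (cov (coordField χ j) p (coordField χ i p)) (coordField χ k p)

/-- The Christoffel symbols `Γ_ij^k`, that is, the `k`-th component of `∇_{∂_i} ∂_j`,
in the coordinates `χ`. -/
noncomputable def christoffel (cov : AffineConnection d M)
    (χ : OpenPartialHomeomorph M (E d)) (i j k : Fin d) (p : M) : ℝ :=
  (mvfderiv (𝓡 d) χ p (cov (coordField χ j) p (coordField χ i p))) k

/-- `c`, defined on the open interval `J`, is the coordinate representation in `χ` of a geodesic: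
`c''ᵏ + Γ_ij^k(c) c'ⁱ c'ʲ = 0`. Such a `C²` curve is automatically smooth. -/
def IsGeodesicInChart (cov : AffineConnection d M) (χ : OpenPartialHomeomorph M (E d))
    (c : ℝ → E d) (J : Set ℝ) : Prop :=
  IsOpen J ∧ J.OrdConnected ∧ ContDiffOn ℝ 2 c J ∧ Set.MapsTo c J χ.target ∧
    ∀ t ∈ J, ∀ k : Fin d,
      (deriv (deriv c) t) k
        + ∑ i, ∑ j, (deriv c t) i * (deriv c t) j * christoffel cov χ i j k (χ.symm (c t)) = 0

/-- In the coordinates `χ` the geodesics are straight lines up to time reparameterization. -/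
def GeodesicsAreStraight (cov : AffineConnection d M) (χ : OpenPartialHomeomorph M (E d)) : Prop :=
  ∀ (c : ℝ → E d) (J : Set ℝ), IsGeodesicInChart cov χ c J →
    ∃ (a v : E d) (h : ℝ → ℝ), ContDiffOn ℝ ∞ h J ∧ (∀ t ∈ J, 0 < deriv h t) ∧
      ∀ t ∈ J, c t = a + h t • v

/-- `φ` is `α`-exponentially concave near each point of `Ω`. -/
def LocallyExpConcave (α : ℝ) (φ : E d → ℝ) (Ω : Set (E d)) : Prop :=
  ∀ x ∈ Ω, ∃ r > 0, Metric.ball x r ⊆ Ω ∧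
    ConcaveOn ℝ (Metric.ball x r) (fun y => Real.exp (α * φ y))

/-- `φ` is `α`-exponentially convex near each point of `Ω`. -/
def LocallyExpConvex (α : ℝ) (φ : E d → ℝ) (Ω : Set (E d)) : Prop :=
  ∀ x ∈ Ω, ∃ r > 0, Metric.ball x r ⊆ Ω ∧
    ConvexOn ℝ (Metric.ball x r) (fun y => Real.exp (α * φ y))

/-- The `α`-gradient `Dφ(x) / (1 - α Dφ(x) · x)`. -/
noncomputable def alphaGradient (α : ℝ) (φ : E d → ℝ) (x : E d) : E d :=
  (1 / (1 - α * inner ℝ (gradient φ x) x)) • gradient φ x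

/-- The cost function `c(x, y) = (1/α) log (1 + α x · y)`. -/
noncomputable def logCost (α : ℝ) (x y : E d) : ℝ :=
  1 / α * Real.log (1 + α * inner ℝ x y)

/-- Local coordinates `ξ`, `η` on a common domain and potentials `φ(ξ)`, `ψ(η)` for a dualistic
structure, as far as their properties do not depend on the sign of the curvature. -/
structure DualPotentials (S : DualisticStructure d M) (α : ℝ) where
  /-- the primal coordinate system -/
  ξ : OpenPartialHomeomorph M (E d)
  /-- the dual coordinate system -/
  η : OpenPartialHomeomorph M (E d)
  /-- the primal potential, a function of `ξ` -/
  φ : E d → ℝ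
  /-- the dual potential, a function of `η` -/
  ψ : E d → ℝ
  ξ_mem : ξ ∈ IsManifold.maximalAtlas (𝓡 d) ∞ M
  η_mem : η ∈ IsManifold.maximalAtlas (𝓡 d) ∞ M
  source_eq : η.source = ξ.source
  smooth_φ : ContDiffOn ℝ ∞ φ ξ.target
  smooth_ψ : ContDiffOn ℝ ∞ ψ η.target
  straight_primal : GeodesicsAreStraight S.primal ξ
  straight_dual : GeodesicsAreStraight S.dual η
  constraint : ∀ p ∈ ξ.source, 0 < 1 + α * inner ℝ (ξ p) (η p)
  fenchel : ∀ p ∈ ξ.source, φ (ξ p) + ψ (η p) = logCost α (ξ p) (η p)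
  gradient_pos : ∀ p ∈ ξ.source, 0 < 1 - α * inner ℝ (gradient φ (ξ p)) (ξ p)
  dual_eq : ∀ p ∈ ξ.source, η p = alphaGradient α φ (ξ p)

namespace DualPotentials

variable {S : DualisticStructure d M} {α : ℝ}

/-- The remaining properties in curvature `-α`: the potentials are locally `α`-exponentially
concave and give the metric. -/
structure IsConcave (P : DualPotentials S α) : Prop where
  concave_φ : LocallyExpConcave α P.φ P.ξ.target
  concave_ψ : LocallyExpConcave α P.ψ P.η.target
  metric_ξ : ∀ p ∈ P.ξ.source, ∀ i j, metricCoeff S.g P.ξ i j p =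
    - partialDeriv i (partialDeriv j P.φ) (P.ξ p)
      - α * partialDeriv i P.φ (P.ξ p) * partialDeriv j P.φ (P.ξ p)
  metric_η : ∀ p ∈ P.ξ.source, ∀ i j, metricCoeff S.g P.η i j p =
    - partialDeriv i (partialDeriv j P.ψ) (P.η p)
      - α * partialDeriv i P.ψ (P.η p) * partialDeriv j P.ψ (P.η p)

/-- The remaining properties in curvature `+α`: the potentials are locally `α`-exponentially
convex and give the metric. -/
structure IsConvex (P : DualPotentials S α) : Prop where
  convex_φ : LocallyExpConvex α P.φ P.ξ.target
  convex_ψ : LocallyExpConvex α P.ψ P.η.target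
  metric_ξ : ∀ p ∈ P.ξ.source, ∀ i j, metricCoeff S.g P.ξ i j p =
    partialDeriv i (partialDeriv j P.φ) (P.ξ p)
      + α * partialDeriv i P.φ (P.ξ p) * partialDeriv j P.φ (P.ξ p)
  metric_η : ∀ p ∈ P.ξ.source, ∀ i j, metricCoeff S.g P.η i j p =
    partialDeriv i (partialDeriv j P.ψ) (P.η p)
      + α * partialDeriv i P.ψ (P.η p) * partialDeriv j P.ψ (P.η p)

/-- The pair `(q, p)` lies in the domain and the logarithm in the divergence `D[q : p]` exists. -/
def Admissible (P : DualPotentials S α) (q p : M) : Prop :=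
  q ∈ P.ξ.source ∧ p ∈ P.ξ.source ∧ 0 < 1 + α * inner ℝ (P.ξ q) (P.η p)

/-- The local `L^(α)`-divergence `D[q : p] = (1/α) log (1 + α ξ_q · η_p) - φ(ξ_q) - ψ(η_p)`. -/
noncomputable def divergence (P : DualPotentials S α) (q p : M) : ℝ :=
  1 / α * Real.log (1 + α * inner ℝ (P.ξ q) (P.η p)) - P.φ (P.ξ q) - P.ψ (P.η p)

/-- The local `L^(-α)`-divergence `D[q : p] = φ(ξ_q) + ψ(η_p) - (1/α) log (1 + α ξ_q · η_p)`. -/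
noncomputable def divergenceNeg (P : DualPotentials S α) (q p : M) : ℝ :=
  P.φ (P.ξ q) + P.ψ (P.η p) - 1 / α * Real.log (1 + α * inner ℝ (P.ξ q) (P.η p))

end DualPotentials

/-- Near the diagonal of `U × U`, the function `D` is smooth, nonnegative, and vanishes exactly on
the diagonal. -/
def IsLocalDivergenceOn (d : ℕ) {M : Type*} [TopologicalSpace M] [ChartedSpace (E d) M]
    (D : M → M → ℝ) (U : Set M) : Prop :=
  ∀ p ∈ U, ContMDiffAt ((𝓡 d).prod (𝓡 d)) 𝓘(ℝ, ℝ) ∞ (fun z : M × M => D z.1 z.2) (p, p) ∧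
    ∀ᶠ z : M × M in 𝓝 (p, p), 0 ≤ D z.1 z.2 ∧ (D z.1 z.2 = 0 ↔ z.1 = z.2)

/-- `D` induces the dualistic structure `S` on `U`: in every local coordinate system, with
`x` the coordinates of the first and `y` those of the second argument of `D`,
`g_ij = -∂_{x i} ∂_{y j} D`, `Γ_ijk = -∂_{x i} ∂_{x j} ∂_{y k} D` and
`Γ*_ijk = -∂_{y i} ∂_{y j} ∂_{x k} D` on the diagonal. -/
structure InducesOn (D : M → M → ℝ) (S : DualisticStructure d M) (U : Set M) : Prop where
  metric : ∀ χ ∈ IsManifold.maximalAtlas (𝓡 d) ∞ M, ∀ p ∈ χ.source ∩ U, ∀ i j,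
    metricCoeff S.g χ i j p =
      - partialDeriv i (fun x => partialDeriv j
          (fun y => D (χ.symm x) (χ.symm y)) (χ p)) (χ p)
  primal : ∀ χ ∈ IsManifold.maximalAtlas (𝓡 d) ∞ M, ∀ p ∈ χ.source ∩ U, ∀ i j k,
    christoffelLower S.g S.primal χ i j k p =
      - partialDeriv i (partialDeriv j (fun x => partialDeriv k
          (fun y => D (χ.symm x) (χ.symm y)) (χ p))) (χ p)
  dual : ∀ χ ∈ IsManifold.maximalAtlas (𝓡 d) ∞ M, ∀ p ∈ χ.source ∩ U, ∀ i j k,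
    christoffelLower S.g S.dual χ i j k p =
      - partialDeriv i (partialDeriv j (fun y => partialDeriv k
          (fun x => D (χ.symm x) (χ.symm y)) (χ p))) (χ p)

end Coordinates

/-! Put `s = -1` in curvature `-α`, `s = 1` in curvature `+α`, so `k = sα`. For fixed `p` consider
`f(q) = (1 + α ξ_q · η_p) e^{-αφ(ξ_q) - αψ(η_p)}`; on admissible pairs the divergence is `-(s/α) log
f`. Everything rests on the equation `∇²f + k f g = 0`.

Straight geodesics force the Christoffel symbols of `∇` in `ξ` to be `a_j δ_i^k + a_i δ_j^k`.
Comparing the duality identity for two orders of its indices, and using `d ≥ 2`, gives `a = -α dφ`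
(`IsSigned.chartDeriv_primal`). With `g = s (D²φ + α Dφ ⊗ Dφ)` it follows that `e^{αφ} (∇²f + k f g)
= D²(f e^{αφ})` for every function `f`. For the `f` above, `f e^{αφ}` is affine in `ξ`, so the
equation holds.

Independence: the equation mentions only `g` and `∇`, and the data `f(p) = 1`, `df(p) = 0` are the
same for every choice of potentials. In one chart two solutions become affine functions with the
same value and derivative; connectedness carries the agreement across `W`.

Local divergence: eliminating `ψ` and `η` shows that `f` is the tangent of `e^{αφ}` at `ξ_p`, taken
at `ξ_q`, divided by `e^{αφ(ξ_q)}`. Since `D²(s e^{αφ}) = α e^{αφ} g` is positive definite, `s (1 -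
f) > 0` off the diagonal.

Induced geometry: minus the derivative of the divergence in its second argument along `v` is a
quotient `B(x - x₀) / (1 + L(x - x₀))` in `x = ξ_q`. At `q = p` its differential is `⟨·, v⟩` and its
`∇`-Hessian vanishes, which gives `g` and `∇`. Exchanging the roles of the two coordinate systems
gives `∇*`. -/

/-! ### Calculus in a chart of the maximal atlas -/

section ChartCalculus

set_option linter.unusedSectionVars false

variable {d : ℕ} {M : Type*} [TopologicalSpace M] [ChartedSpace (E d) M] [IsManifold (𝓡 d) ∞ M]
  {χ : OpenPartialHomeomorph M (E d)}

/-- The differential of a coordinate system, as a map into the model space. -/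
noncomputable abbrev chartDeriv (χ : OpenPartialHomeomorph M (E d)) (q : M) :
    TangentSpace (𝓡 d) q →L[ℝ] E d :=
  mvfderiv (𝓡 d) χ q

theorem chart_mdifferentiable (hχ : χ ∈ IsManifold.maximalAtlas (𝓡 d) ∞ M) :
    χ.MDifferentiable (𝓡 d) 𝓘(ℝ, E d) :=
  ⟨(contMDiffOn_of_mem_maximalAtlas hχ).mdifferentiableOn (by simp),
    (contMDiffOn_symm_of_mem_maximalAtlas hχ).mdifferentiableOn (by simp)⟩

theorem mfderiv_chart_isInvertible (hχ : χ ∈ IsManifold.maximalAtlas (𝓡 d) ∞ M) {q : M}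
    (hq : q ∈ χ.source) : (mfderiv (𝓡 d) 𝓘(ℝ, E d) χ q).IsInvertible :=
  ⟨(chart_mdifferentiable hχ).mfderiv hq, rfl⟩

theorem chartDeriv_coordField (hχ : χ ∈ IsManifold.maximalAtlas (𝓡 d) ∞ M) {q : M}
    (hq : q ∈ χ.source) (i : Fin d) :
    chartDeriv χ q (coordField χ i q) = EuclideanSpace.single i 1 := by
  have h := (mfderiv_chart_isInvertible hχ hq).self_apply_inverse
    ((NormedSpace.fromTangentSpace (χ q)).symm (EuclideanSpace.single i (1 : ℝ)))
  simp only [chartDeriv, mvfderiv, coordField, VectorField.mpullback_apply]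
  erw [ContinuousLinearMap.comp_apply, h]
  rfl

theorem chartDeriv_injective (hχ : χ ∈ IsManifold.maximalAtlas (𝓡 d) ∞ M) {q : M}
    (hq : q ∈ χ.source) : Function.Injective (chartDeriv χ q) :=
  (chart_mdifferentiable hχ).mfderiv_injective hq

theorem eq_sum_coordField (hχ : χ ∈ IsManifold.maximalAtlas (𝓡 d) ∞ M) {q : M}
    (hq : q ∈ χ.source) (v : TangentSpace (𝓡 d) q) :
    v = ∑ i, (chartDeriv χ q v) i • coordField χ i q := by
  apply chartDeriv_injective hχ hq
  simp only [map_sum, map_smul, chartDeriv_coordField hχ hq]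
  ext j
  simp [Finset.sum_apply, Pi.single_apply]

theorem contMDiffAt_coordField (hχ : χ ∈ IsManifold.maximalAtlas (𝓡 d) ∞ M) {q : M}
    (hq : q ∈ χ.source) (i : Fin d) :
    ContMDiffAt (𝓡 d) (𝓡 d).tangent ∞
      (fun x => (⟨x, coordField χ i x⟩ : TangentBundle (𝓡 d) M)) q := by
  refine ContMDiffAt.mpullback_vectorField_preimage (n := ∞) ?_
    (contMDiffAt_of_mem_maximalAtlas hχ hq) (mfderiv_chart_isInvertible hχ hq) (by simp)
  rw [← contMDiffWithinAt_univ, contMDiffWithinAt_vectorSpace_iff_contDiffWithinAt]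
  exact contDiffWithinAt_const

theorem smoothFieldOn_coordField (hχ : χ ∈ IsManifold.maximalAtlas (𝓡 d) ∞ M) (i : Fin d) :
    SmoothFieldOn (coordField χ i) χ.source :=
  fun _ hq => (contMDiffAt_coordField hχ hq i).contMDiffWithinAt

theorem mdifferentiableAt_coordField (hχ : χ ∈ IsManifold.maximalAtlas (𝓡 d) ∞ M) {q : M}
    (hq : q ∈ χ.source) (i : Fin d) :
    MDifferentiableAt (𝓡 d) (𝓡 d).tangent
      (fun x => (⟨x, coordField χ i x⟩ : TangentBundle (𝓡 d) M)) q :=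
  (contMDiffAt_coordField hχ hq i).mdifferentiableAt (by simp)

/-- Coordinate fields are pullbacks of constant fields, and pullback commutes with the bracket. -/
theorem mlieBracket_coordField (hχ : χ ∈ IsManifold.maximalAtlas (𝓡 d) ∞ M) {q : M}
    (hq : q ∈ χ.source) (i j : Fin d) :
    VectorField.mlieBracket (𝓡 d) (coordField χ i) (coordField χ j) q = 0 := by
  have hc : ∀ i : Fin d, MDifferentiableAt 𝓘(ℝ, E d) 𝓘(ℝ, E d).tangent
      (fun y => (⟨y, (NormedSpace.fromTangentSpace y).symm (EuclideanSpace.single i 1)⟩ :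
        TangentBundle 𝓘(ℝ, E d) (E d))) (χ q) := by
    intro i
    refine ContMDiffAt.mdifferentiableAt (n := ∞) ?_ (by simp)
    rw [← contMDiffWithinAt_univ, contMDiffWithinAt_vectorSpace_iff_contDiffWithinAt]
    exact contDiffWithinAt_const
  have h2 : minSmoothness ℝ 2 ≤ (∞ : ℕ∞ω) := by
    rw [minSmoothness_of_isRCLikeNormedField]
    exact ENat.LEInfty.out
  have : IsManifold 𝓘(ℝ, E d) (minSmoothness ℝ 2) M := IsManifold.of_le h2
  have h := VectorField.mpullback_mlieBracket (n := ∞) (hc i) (hc j)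
    (contMDiffAt_of_mem_maximalAtlas hχ hq) h2
  have h0 : VectorField.mlieBracket 𝓘(ℝ, E d)
      (fun y : E d => (NormedSpace.fromTangentSpace y).symm (EuclideanSpace.single i 1))
      (fun y : E d => (NormedSpace.fromTangentSpace y).symm (EuclideanSpace.single j 1)) (χ q)
        = 0 := by
    rw [← VectorField.mlieBracketWithin_univ, VectorField.mlieBracketWithin_eq_lieBracketWithin]
    have : VectorField.lieBracketWithin ℝ (fun _ : E d => EuclideanSpace.single i (1 : ℝ))
        (fun _ : E d => EuclideanSpace.single j (1 : ℝ)) Set.univ (χ q) = 0 := by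
      simp [VectorField.lieBracketWithin]
    exact this
  rw [coordField, coordField, ← h, VectorField.mpullback_apply, h0, map_zero]

section Functions

variable {F : Type*} [NormedAddCommGroup F] [NormedSpace ℝ F]

theorem mvfderiv_eq_fderiv_chart
    (hχ : χ ∈ IsManifold.maximalAtlas (𝓡 d) ∞ M) {q : M}
    (hq : q ∈ χ.source) {f : M → F} (hf : MDifferentiableAt (𝓡 d) 𝓘(ℝ, F) f q)
    (v : TangentSpace (𝓡 d) q) :
    mvfderiv (𝓡 d) f q v = fderiv ℝ (f ∘ χ.symm) (χ q) (chartDeriv χ q v) := by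
  have hχd := chart_mdifferentiable hχ
  have hg : MDifferentiableAt 𝓘(ℝ, E d) 𝓘(ℝ, F) (f ∘ χ.symm) (χ q) := by
    refine MDifferentiableAt.comp _ ?_ (hχd.mdifferentiableAt_symm (χ.map_source hq))
    rwa [χ.left_inv hq]
  have heq : f =ᶠ[𝓝 q] (f ∘ χ.symm) ∘ χ := by
    filter_upwards [χ.open_source.mem_nhds hq] with x hx
    simp [χ.left_inv hx]
  have h1 : HasMFDerivAt (𝓡 d) 𝓘(ℝ, F) f q
      ((mfderiv 𝓘(ℝ, E d) 𝓘(ℝ, F) (f ∘ χ.symm) (χ q)).comp (mfderiv (𝓡 d) 𝓘(ℝ, E d) χ q)) :=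
    (hg.hasMFDerivAt.comp q (hχd.mdifferentiableAt hq).hasMFDerivAt).congr_of_eventuallyEq heq
  rw [mfderiv_eq_fderiv] at h1
  simp only [mvfderiv, h1.mfderiv]
  rfl

theorem mvfderiv_coordField
    (hχ : χ ∈ IsManifold.maximalAtlas (𝓡 d) ∞ M) {q : M}
    (hq : q ∈ χ.source) {f : M → ℝ} (hf : MDifferentiableAt (𝓡 d) 𝓘(ℝ, ℝ) f q) (i : Fin d) :
    mvfderiv (𝓡 d) f q (coordField χ i q) = partialDeriv i (f ∘ χ.symm) (χ q) := by
  rw [mvfderiv_eq_fderiv_chart hχ hq hf, chartDeriv_coordField hχ hq, partialDeriv]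

theorem contMDiffWithinAt_mvfderiv_apply {f : M → F} {s : Set M} {q : M} {n m : ℕ∞ω}
    (hf : ContMDiffAt (𝓡 d) 𝓘(ℝ, F) n f q) (hmn : m + 1 ≤ n)
    (X : ∀ x : M, TangentSpace (𝓡 d) x)
    (hX : ContMDiffWithinAt (𝓡 d) (𝓡 d).tangent m
      (fun x => (⟨x, X x⟩ : TangentBundle (𝓡 d) M)) s q) :
    ContMDiffWithinAt (𝓡 d) 𝓘(ℝ, F) m (fun x => mvfderiv (𝓡 d) f x (X x)) s q := by
  have hm : m ≤ n := le_self_add.trans hmn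
  have hϕ : ContMDiffWithinAt (𝓡 d) 𝓘(ℝ, E d →L[ℝ] F) m
      (fun x => ContinuousLinearMap.inCoordinates (E d) (TangentSpace (𝓡 d) (M := M)) F
        (TangentSpace 𝓘(ℝ, F) (M := F)) q x (f q) (f x) (mfderiv (𝓡 d) 𝓘(ℝ, F) f x)) s q :=
    (ContMDiffAt.mfderiv_const hf hmn).contMDiffWithinAt
  have h := ContMDiffWithinAt.clm_apply_of_inCoordinates hϕ hX (hf.of_le hm).contMDiffWithinAt
  exact (contMDiff_snd_tangentBundle_modelSpace F 𝓘(ℝ, F)).contMDiffAt.comp_contMDiffWithinAt q h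

/-- A version for fields that are only differentiable at one point, the class over which
tensoriality quantifies. -/
theorem mdifferentiableAt_mvfderiv_apply {f : M → F} {q : M}
    (hf : ContMDiffAt (𝓡 d) 𝓘(ℝ, F) 2 f q)
    (X : ∀ x : M, TangentSpace (𝓡 d) x)
    (hX : MDifferentiableAt (𝓡 d) (𝓡 d).tangent
      (fun x => (⟨x, X x⟩ : TangentBundle (𝓡 d) M)) q) :
    MDifferentiableAt (𝓡 d) 𝓘(ℝ, F) (fun x => mvfderiv (𝓡 d) f x (X x)) q := by
  have hϕ : MDifferentiableWithinAt (𝓡 d) 𝓘(ℝ, E d →L[ℝ] F)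
      (fun x => ContinuousLinearMap.inCoordinates (E d) (TangentSpace (𝓡 d) (M := M)) F
        (TangentSpace 𝓘(ℝ, F) (M := F)) q x (f q) (f x) (mfderiv (𝓡 d) 𝓘(ℝ, F) f x)) Set.univ q :=
    ((ContMDiffAt.mfderiv_const (m := 1) hf (by norm_num)).mdifferentiableAt
      one_ne_zero).mdifferentiableWithinAt
  have h := MDifferentiableWithinAt.clm_apply_of_inCoordinates hϕ
    hX.mdifferentiableWithinAt (hf.mdifferentiableAt two_ne_zero).mdifferentiableWithinAt
  rw [mdifferentiableWithinAt_univ] at h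
  exact ((contMDiff_snd_tangentBundle_modelSpace F 𝓘(ℝ, F)).contMDiffAt.mdifferentiableAt
    one_ne_zero).comp q h

end Functions

end ChartCalculus

/-! ### Bases and partial derivatives in `ℝᵈ` -/

section ModelSpace

variable {d : ℕ}

theorem EuclideanSpace.eq_sum_single (a : E d) : a = ∑ i, a i • EuclideanSpace.single i (1 : ℝ) := by
  ext j
  simp [Finset.sum_apply, Pi.single_apply]

theorem ContinuousLinearMap.apply_eq_sum_single {F : Type*} [NormedAddCommGroup F] [NormedSpace ℝ F]
    (B : E d →L[ℝ] F) (a : E d) : B a = ∑ i, a i • B (EuclideanSpace.single i 1) := by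
  conv_lhs => rw [EuclideanSpace.eq_sum_single a]
  simp

theorem ContinuousLinearMap.apply_apply_eq_sum_single (B : E d →L[ℝ] E d →L[ℝ] ℝ) (a b : E d) :
    B a b = ∑ j, b j * ∑ i, a i * B (EuclideanSpace.single i 1) (EuclideanSpace.single j 1) := by
  rw [(B a).apply_eq_sum_single b]
  refine Finset.sum_congr rfl fun j _ => ?_
  rw [B.apply_eq_sum_single a]
  simp [sum_apply]

theorem partialDeriv_partialDeriv {f : E d → ℝ} {x : E d} (hf : ContDiffAt ℝ 2 f x) (i j : Fin d) :
    partialDeriv i (partialDeriv j f) x =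
      fderiv ℝ (fderiv ℝ f) x (EuclideanSpace.single i 1) (EuclideanSpace.single j 1) := by
  have h : DifferentiableAt ℝ (fderiv ℝ f) x :=
    (hf.fderiv_right (m := 1) (by norm_num)).differentiableAt one_ne_zero
  unfold partialDeriv
  rw [fderiv_clm_apply h (differentiableAt_const _)]
  simp

theorem partialDeriv_comm {f : E d → ℝ} {x : E d} (hf : ContDiffAt ℝ 2 f x) (i j : Fin d) :
    partialDeriv i (partialDeriv j f) x = partialDeriv j (partialDeriv i f) x := by
  rw [partialDeriv_partialDeriv hf, partialDeriv_partialDeriv hf]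
  exact (hf.isSymmSndFDerivAt (by simp)).eq _ _

theorem ContDiffAt.partialDeriv {f : E d → ℝ} {x : E d} {n m : ℕ∞ω} (hf : ContDiffAt ℝ n f x)
    (hmn : m + 1 ≤ n) (i : Fin d) : ContDiffAt ℝ m (_root_.partialDeriv i f) x := by
  have h : ContDiffAt ℝ m (fderiv ℝ f) x := hf.fderiv_right hmn
  exact h.clm_apply contDiffAt_const

theorem Filter.EventuallyEq.partialDeriv {f g : E d → ℝ} {x : E d} (h : f =ᶠ[𝓝 x] g) (i : Fin d) :
    partialDeriv i f =ᶠ[𝓝 x] partialDeriv i g := by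
  filter_upwards [h.fderiv (𝕜 := ℝ)] with y hy
  simp only [_root_.partialDeriv, hy]

theorem partialDeriv_left_comm {f : E d → ℝ} {x : E d} (hf : ContDiffAt ℝ ∞ f x) (i j k : Fin d) :
    partialDeriv i (partialDeriv j (partialDeriv k f)) x =
      partialDeriv k (partialDeriv j (partialDeriv i f)) x := by
  have h2 : (2 : ℕ∞ω) ≤ ∞ := ENat.LEInfty.out
  have hev : ∀ᶠ y in 𝓝 x, ContDiffAt ℝ 2 f y := (hf.of_le h2).eventually (by simp)
  have hsw : ∀ i j : Fin d, partialDeriv i (partialDeriv j f) =ᶠ[𝓝 x]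
      partialDeriv j (partialDeriv i f) := fun i j => by
    filter_upwards [hev] with y hy using partialDeriv_comm hy i j
  rw [((hsw j k).partialDeriv i).eq_of_nhds, ((hsw j i).partialDeriv k).eq_of_nhds]
  exact partialDeriv_comm ((hf.partialDeriv (m := ∞) (by simp) j).of_le h2) i k

end ModelSpace

/-! ### The Hessian of a function with respect to a connection -/

section Hessian

set_option linter.unusedSectionVars false

variable {d : ℕ} {M : Type*} [TopologicalSpace M] [ChartedSpace (E d) M] [IsManifold (𝓡 d) ∞ M]
  {χ : OpenPartialHomeomorph M (E d)}

/-- The Hessian `X ↦ X (Y h) - (∇_X Y) h` of a function with respect to a connection. -/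
noncomputable def covHessian (cov : AffineConnection d M) (h : M → ℝ)
    (Y : ∀ x : M, TangentSpace (𝓡 d) x) (p : M) : TangentSpace (𝓡 d) p →L[ℝ] ℝ :=
  mvfderiv (𝓡 d) (fun q => mvfderiv (𝓡 d) h q (Y q)) p - (mvfderiv (𝓡 d) h p) ∘L (cov Y p)

/-- `X (Y h)` and `(∇_X Y) h` obey the same Leibniz rule in `Y`, so derivatives of the coefficient
cancel in the difference. -/
theorem covHessian_tensorial (cov : AffineConnection d M) {h : M → ℝ} {p : M}
    (hh : ContMDiffAt (𝓡 d) 𝓘(ℝ, ℝ) 2 h p) :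
    TensorialAt (𝓡 d) (E d) (fun Y => covHessian cov h Y p) p where
  smul {f σ} hf hσ := by
    have h1 := mdifferentiableAt_mvfderiv_apply hh σ hσ
    ext u
    have : (fun q => mvfderiv (𝓡 d) h q ((f • σ) q)) =
      fun q => f q * mvfderiv (𝓡 d) h q (σ q) := by
      ext q; simp
    simp only [covHessian, this, mvfderiv_fun_mul hf h1, 
      cov.isCovariantDerivativeOn.leibniz hσ hf (Set.mem_univ p)]
    simp
    ring
  add {σ σ'} hσ hσ' := by
    have h1 := mdifferentiableAt_mvfderiv_apply hh σ hσ
    have h2 := mdifferentiableAt_mvfderiv_apply hh σ' hσ'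
    ext u
    have : (fun q => mvfderiv (𝓡 d) h q ((σ + σ') q)) =
      fun q => mvfderiv (𝓡 d) h q (σ q) + mvfderiv (𝓡 d) h q (σ' q) := by
      ext q; simp
    simp only [covHessian, this, mvfderiv_fun_add h1 h2, 
      cov.isCovariantDerivativeOn.add hσ hσ' (Set.mem_univ p)]
    simp
    ring

theorem contDiffAt_comp_chart_symm (hχ : χ ∈ IsManifold.maximalAtlas (𝓡 d) ∞ M) {p : M}
    (hp : p ∈ χ.source) {F : Type*} [NormedAddCommGroup F] [NormedSpace ℝ F] {n : ℕ∞ω} (hn : n ≤ ∞)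
    {h : M → F} (hh : ContMDiffAt (𝓡 d) 𝓘(ℝ, F) n h p) : ContDiffAt ℝ n (h ∘ χ.symm) (χ p) := by
  rw [← contMDiffAt_iff_contDiffAt]
  refine ContMDiffAt.comp _ ?_ ((contMDiffAt_symm_of_mem_maximalAtlas hχ (χ.map_source hp)).of_le hn)
  rwa [χ.left_inv hp]

theorem covHessian_coordField (cov : AffineConnection d M)
    (hχ : χ ∈ IsManifold.maximalAtlas (𝓡 d) ∞ M) {p : M} (hp : p ∈ χ.source) {h : M → ℝ}
    (hh : ContMDiffAt (𝓡 d) 𝓘(ℝ, ℝ) 2 h p) (i j : Fin d) :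
    covHessian cov h (coordField χ j) p (coordField χ i p) =
      partialDeriv i (partialDeriv j (h ∘ χ.symm)) (χ p) -
        mvfderiv (𝓡 d) h p (cov (coordField χ j) p (coordField χ i p)) := by
  have h1 := mdifferentiableAt_mvfderiv_apply hh _ (mdifferentiableAt_coordField hχ hp j)
  simp only [covHessian, sub_apply, ContinuousLinearMap.comp_apply]
  rw [mvfderiv_coordField hχ hp h1]
  congr 1
  refine (Filter.EventuallyEq.partialDeriv ?_ i).eq_of_nhds
  have hev : ∀ᶠ q in 𝓝 p, ContMDiffAt (𝓡 d) 𝓘(ℝ, ℝ) 2 h q ∧ q ∈ χ.source :=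
    ((contMDiffAt_iff_contMDiffAt_nhds (by simp)).1 hh).and (χ.open_source.mem_nhds hp)
  have hev' := (χ.continuousAt_symm (χ.map_source hp)).eventually
    (by rw [χ.left_inv hp]; exact hev)
  filter_upwards [hev', χ.open_target.mem_nhds (χ.map_source hp)] with y hy hyt
  simp only [Function.comp_apply]
  rw [mvfderiv_coordField hχ hy.2 (hy.1.mdifferentiableAt two_ne_zero), χ.right_inv hyt]

/-- In coordinates in which a connection has Christoffel symbols `a_j δ_i^k + a_i δ_j^k`,
the Hessian of a function has an explicit expression. -/
theorem covHessian_eq_of_projective {cov : AffineConnection d M}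
    (hχ : χ ∈ IsManifold.maximalAtlas (𝓡 d) ∞ M) {p : M} (hp : p ∈ χ.source) {a : E d →L[ℝ] ℝ}
    (ha : ∀ i j, chartDeriv χ p (cov (coordField χ j) p (coordField χ i p)) =
      a (EuclideanSpace.single j 1) • EuclideanSpace.single i 1 +
        a (EuclideanSpace.single i 1) • EuclideanSpace.single j 1)
    {h : M → ℝ} (hh : ContMDiffAt (𝓡 d) 𝓘(ℝ, ℝ) 2 h p) {Y : ∀ x : M, TangentSpace (𝓡 d) x}
    (hY : MDifferentiableAt (𝓡 d) (𝓡 d).tangent (fun x => (⟨x, Y x⟩ : TangentBundle (𝓡 d) M)) p)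
    (u : TangentSpace (𝓡 d) p) :
    covHessian cov h Y p u =
      fderiv ℝ (fderiv ℝ (h ∘ χ.symm)) (χ p) (chartDeriv χ p u) (chartDeriv χ p (Y p)) -
        (a (chartDeriv χ p (Y p)) * fderiv ℝ (h ∘ χ.symm) (χ p) (chartDeriv χ p u) +
          a (chartDeriv χ p u) * fderiv ℝ (h ∘ χ.symm) (χ p) (chartDeriv χ p (Y p))) := by
  have hT := covHessian_tensorial cov hh
  have hc : ∀ j, MDifferentiableAt (𝓡 d) (𝓡 d).tangent
      (fun x => (⟨x, coordField χ j x⟩ : TangentBundle (𝓡 d) M)) p :=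
    mdifferentiableAt_coordField hχ hp
  have hbasis : ∀ i j, covHessian cov h (coordField χ j) p (coordField χ i p) =
      fderiv ℝ (fderiv ℝ (h ∘ χ.symm)) (χ p) (EuclideanSpace.single i 1)
        (EuclideanSpace.single j 1) -
        (a (EuclideanSpace.single j 1) * fderiv ℝ (h ∘ χ.symm) (χ p) (EuclideanSpace.single i 1) +
          a (EuclideanSpace.single i 1) *
            fderiv ℝ (h ∘ χ.symm) (χ p) (EuclideanSpace.single j 1)) := by
    intro i j
    rw [covHessian_coordField cov hχ hp hh, partialDeriv_partialDeriv
      (contDiffAt_comp_chart_symm hχ hp ENat.LEInfty.out hh),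
      mvfderiv_eq_fderiv_chart hχ hp (hh.mdifferentiableAt two_ne_zero), ha]
    simp
  -- By tensoriality `Y` may be replaced by the combination of coordinate fields with constant
  -- coefficients that agrees with it at `p`.
  have hsum : covHessian cov h Y p = ∑ j, chartDeriv χ p (Y p) j •
      covHessian cov h (coordField χ j) p := by
    have hcs : ∀ j ∈ Finset.univ, MDifferentiableAt (𝓡 d) (𝓡 d).tangent
        (fun x => (⟨x, ((fun _ : M => chartDeriv χ p (Y p) j) • coordField χ j) x⟩ :
          TangentBundle (𝓡 d) M)) p := fun j _ =>
      MDifferentiableAt.smul_section mdifferentiableAt_const (hc j)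
    rw [hT.pointwise hY (MDifferentiableAt.sum_section hcs)
      (by simpa using eq_sum_coordField hχ hp (Y p)), hT.sum _ hcs]
    exact Finset.sum_congr rfl fun j _ => hT.smul mdifferentiableAt_const (hc j)
  have hR := ContinuousLinearMap.apply_apply_eq_sum_single
    (fderiv ℝ (fderiv ℝ (h ∘ χ.symm)) (χ p) - ((fderiv ℝ (h ∘ χ.symm) (χ p)).smulRight a +
      a.smulRight (fderiv ℝ (h ∘ χ.symm) (χ p)))) (chartDeriv χ p u) (chartDeriv χ p (Y p))
  simp only [sub_apply, add_apply, ContinuousLinearMap.smulRight_apply, smul_apply,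
    smul_eq_mul] at hR
  rw [hsum, mul_comm (a _), hR, sum_apply]
  refine Finset.sum_congr rfl fun j _ => ?_
  conv_lhs => rw [eq_sum_coordField hχ hp u]
  rw [smul_apply, map_sum, smul_eq_mul]
  congr 1
  refine Finset.sum_congr rfl fun i _ => ?_
  rw [map_smul, hbasis, smul_eq_mul]
  ring

end Hessian

/-! ### Second order differential equations -/

section SecondOrderODE

/-- Local existence for second order equations `c'' = F (c, c')`. -/
theorem exists_solution_second_order {V : Type*} [NormedAddCommGroup V] [NormedSpace ℝ V]
    [CompleteSpace V] {Ω : Set V} (hΩ : IsOpen Ω) {F : V × V → V}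
    (hF : ContDiffOn ℝ 1 F (Ω ×ˢ Set.univ)) {x₀ : V} (hx₀ : x₀ ∈ Ω) (v₀ : V) :
    ∃ (c : ℝ → V), ∃ ε > (0 : ℝ), c 0 = x₀ ∧ deriv c 0 = v₀ ∧
      ContDiffOn ℝ 2 c (Set.Ioo (-ε) ε) ∧ Set.MapsTo c (Set.Ioo (-ε) ε) Ω ∧
      ∀ t ∈ Set.Ioo (-ε) ε, deriv (deriv c) t = F (c t, deriv c t) := by
  have hopen : IsOpen (Ω ×ˢ (Set.univ : Set V)) := hΩ.prod isOpen_univ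
  -- The equation as a first order system for the pair `(c, c')`.
  have hf : ContDiffAt ℝ 1 (fun z : V × V => (z.2, F z)) (x₀, v₀) :=
    contDiffAt_snd.prodMk (hF.contDiffAt (hopen.mem_nhds ⟨hx₀, trivial⟩))
  obtain ⟨γ, hγ0, ε, hε, hγ⟩ :=
    hf.exists_forall_mem_closedBall_exists_eq_forall_mem_Ioo_hasDerivAt₀ 0
  simp only [zero_sub, zero_add] at hγ
  have hcont : ContinuousAt γ 0 := (hγ 0 ⟨by linarith, hε⟩).continuousAt
  have hmem : ∀ᶠ t in 𝓝 (0 : ℝ), (γ t).1 ∈ Ω :=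
    (continuous_fst.continuousAt.comp hcont).eventually
      (hΩ.mem_nhds (by simpa [hγ0] using hx₀))
  obtain ⟨δ, hδ, hδΩ⟩ := Metric.eventually_nhds_iff.1 hmem
  -- The solution of the system may leave `Ω`, so its interval is shortened.
  set r := min ε δ
  have hr : 0 < r := lt_min hε hδ
  have hsub : Set.Ioo (-r) r ⊆ Set.Ioo (-ε) ε :=
    Set.Ioo_subset_Ioo (neg_le_neg (min_le_left _ _)) (min_le_left _ _)
  have hc : ∀ t ∈ Set.Ioo (-r) r, HasDerivAt (fun t => (γ t).1) (γ t).2 t := fun t ht =>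
    (hγ t (hsub ht)).fst
  have hv : ∀ t ∈ Set.Ioo (-r) r, HasDerivAt (fun t => (γ t).2) (F (γ t)) t := fun t ht =>
    (hγ t (hsub ht)).snd
  have hd : ∀ t ∈ Set.Ioo (-r) r, deriv (fun t => (γ t).1) t = (γ t).2 := fun t ht =>
    (hc t ht).deriv
  have hdd : ∀ t ∈ Set.Ioo (-r) r, HasDerivAt (deriv (fun t => (γ t).1)) (F (γ t)) t := by
    intro t ht
    refine (hv t ht).congr_of_eventuallyEq ?_
    filter_upwards [isOpen_Ioo.mem_nhds ht] with s hs using hd s hs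
  have hmaps : Set.MapsTo (fun t => (γ t).1) (Set.Ioo (-r) r) Ω := by
    intro t ht
    refine hδΩ ?_
    rw [Real.dist_eq, sub_zero, abs_lt]
    exact ⟨by linarith [ht.1, min_le_right ε δ], ht.2.trans_le (min_le_right _ _)⟩
  have h0 : (0 : ℝ) ∈ Set.Ioo (-r) r := ⟨by linarith, hr⟩
  refine ⟨fun t => (γ t).1, r, hr, by simp [hγ0], by rw [hd 0 h0, hγ0], ?_, hmaps,
    fun t ht => by rw [(hdd t ht).deriv, hd t ht]⟩
  have hγc : ContinuousOn γ (Set.Ioo (-r) r) := fun t ht =>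
    (hγ t (hsub ht)).continuousAt.continuousWithinAt
  have hFc : ContinuousOn (fun t => F (γ t)) (Set.Ioo (-r) r) :=
    hF.continuousOn.comp hγc fun t ht => ⟨hmaps ht, trivial⟩
  rw [show (2 : ℕ∞ω) = 1 + 1 by norm_num, contDiffOn_succ_iff_deriv_of_isOpen isOpen_Ioo]
  refine ⟨fun t ht => (hc t ht).differentiableAt.differentiableWithinAt, by simp, ?_⟩
  rw [show (1 : ℕ∞ω) = 0 + 1 by norm_num, contDiffOn_succ_iff_deriv_of_isOpen isOpen_Ioo]
  refine ⟨fun t ht => (hdd t ht).differentiableAt.differentiableWithinAt, by simp, ?_⟩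
  rw [contDiffOn_zero]
  exact hFc.congr fun t ht => (hdd t ht).deriv

end SecondOrderODE

/-! ### Connections with straight geodesics -/

section Geodesics

set_option linter.unusedSectionVars false

variable {d : ℕ} {M : Type*} [TopologicalSpace M] [ChartedSpace (E d) M] [IsManifold (𝓡 d) ∞ M]
  {χ : OpenPartialHomeomorph M (E d)}

/-- The coordinate expression of `∇_{∂_i} ∂_j`, as a function on the coordinate domain. -/
noncomputable def chartConnection (cov : AffineConnection d M) (χ : OpenPartialHomeomorph M (E d))
    (i j : Fin d) (x : E d) : E d :=
  chartDeriv χ (χ.symm x) (cov (coordField χ j) (χ.symm x) (coordField χ i (χ.symm x)))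

theorem contDiffOn_chartConnection {cov : AffineConnection d M} (hcov : SmoothConnection cov)
    (hχ : χ ∈ IsManifold.maximalAtlas (𝓡 d) ∞ M) (i j : Fin d) :
    ContDiffOn ℝ ∞ (chartConnection cov χ i j) χ.target := by
  have h1 := hcov χ.source χ.open_source _ _ (smoothFieldOn_coordField hχ i)
    (smoothFieldOn_coordField hχ j)
  have h2 : ContMDiffOn (𝓡 d) 𝓘(ℝ, E d) ∞ (fun q => chartDeriv χ q
      (cov (coordField χ j) q (coordField χ i q))) χ.source := fun q hq =>
    contMDiffWithinAt_mvfderiv_apply (contMDiffAt_of_mem_maximalAtlas hχ hq) (by simp) _ (h1 q hq)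
  rw [← contMDiffOn_iff_contDiffOn]
  exact h2.comp (contMDiffOn_symm_of_mem_maximalAtlas hχ) χ.mapsTo_symm

theorem christoffel_symm_apply (cov : AffineConnection d M) (i j k : Fin d) (x : E d) :
    christoffel cov χ i j k (χ.symm x) = chartConnection cov χ i j x k :=
  rfl

/-- If geodesics are straight lines then `∇_v v` is proportional to `v` for constant `v`. -/
theorem exists_smul_of_geodesicsAreStraight {cov : AffineConnection d M}
    (hcov : SmoothConnection cov) (hχ : χ ∈ IsManifold.maximalAtlas (𝓡 d) ∞ M)
    (hstr : GeodesicsAreStraight cov χ) {x : E d} (hx : x ∈ χ.target) (v : E d) :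
    ∃ c : ℝ, ∑ i, ∑ j, (v i * v j) • chartConnection cov χ i j x = c • v := by
  have hF : ContDiffOn ℝ 1
      (fun z : E d × E d => - ∑ i, ∑ j, (z.2 i * z.2 j) • chartConnection cov χ i j z.1)
      (χ.target ×ˢ Set.univ) := by
    refine ContDiffOn.neg (ContDiffOn.sum fun i _ => ContDiffOn.sum fun j _ =>
      ContDiffOn.fun_smul ?_ ?_)
    · exact ContDiff.contDiffOn (by fun_prop)
    · exact ((contDiffOn_chartConnection hcov hχ i j).of_le (by norm_num)).comp
        contDiff_fst.contDiffOn fun z hz => hz.1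
  -- A geodesic through `x` with velocity `v`. Being straight, it has `c'' = h'' w` with `w`
  -- parallel to `v`, and the geodesic equation at time `0` turns this into the claim.
  obtain ⟨c, ε, hε, hc0, hc1, hc2, hmaps, hode⟩ :=
    exists_solution_second_order χ.open_target hF hx v
  have h0 : (0 : ℝ) ∈ Set.Ioo (-ε) ε := ⟨by linarith, hε⟩
  obtain ⟨a, w, h, hh, hpos, hch⟩ := hstr c (Set.Ioo (-ε) ε)
    ⟨isOpen_Ioo, Set.ordConnected_Ioo, hc2, hmaps, fun t ht k => by
      rw [hode t ht]
      simp [christoffel_symm_apply]⟩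
  have hd : ∀ t ∈ Set.Ioo (-ε) ε, deriv c t = deriv h t • w := by
    intro t ht
    have : c =ᶠ[𝓝 t] fun t => a + h t • w := by
      filter_upwards [isOpen_Ioo.mem_nhds ht] with s hs using hch s hs
    rw [this.deriv_eq]
    have hht : DifferentiableAt ℝ h t :=
      (hh.contDiffAt (isOpen_Ioo.mem_nhds ht)).differentiableAt (by simp)
    exact ((hht.hasDerivAt.smul_const w).const_add a).deriv
  have hdd : deriv (deriv c) 0 = deriv (deriv h) 0 • w := by
    have : deriv c =ᶠ[𝓝 0] fun t => deriv h t • w := by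
      filter_upwards [isOpen_Ioo.mem_nhds h0] with s hs using hd s hs
    rw [this.deriv_eq]
    have hht : DifferentiableAt ℝ (deriv h) 0 :=
      ((hh.deriv_of_isOpen (m := 1) isOpen_Ioo
        (by rw [one_add_one_eq_two]; exact ENat.LEInfty.out)).contDiffAt
        (isOpen_Ioo.mem_nhds h0)).differentiableAt one_ne_zero
    exact (hht.hasDerivAt.smul_const w).deriv
  have hne : deriv h 0 ≠ 0 := (hpos 0 h0).ne'
  have hw : w = (deriv h 0)⁻¹ • v := by
    rw [← hc1, hd 0 h0, inv_smul_smul₀ hne]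
  have := hode 0 h0
  rw [hdd, hc0, hc1, hw] at this
  refine ⟨- (deriv (deriv h) 0 * (deriv h 0)⁻¹), ?_⟩
  rw [neg_smul, mul_smul, this, neg_neg]

end Geodesics

/-! ### Polarization of `Γ(v, v) ∥ v` -/

section ProjectiveAlgebra

/-- A symmetric vector-valued bilinear form with `Γ(v, v)` always proportional to `v` has
the form `Γ(v, w) = a(w) v + a(v) w`. -/
theorem exists_eq_add_of_forall_smul {d : ℕ} {Γ : Fin d → Fin d → E d}
    (hsymm : ∀ i j, Γ i j = Γ j i) (h : ∀ v : E d, ∃ c : ℝ, ∑ i, ∑ j, (v i * v j) • Γ i j = c • v) :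
    ∃ a : Fin d → ℝ, ∀ i j, Γ i j =
      a j • EuclideanSpace.single i (1 : ℝ) + a i • EuclideanSpace.single j (1 : ℝ) := by
  -- The hypothesis at `e_i + t e_j`. The value `t = 0` gives `Γ_ii`; comparing components for `t =
  -- 1` and `t = -1` determines `Γ_ij`.
  have hQ : ∀ (i j : Fin d) (t : ℝ), ∃ c : ℝ,
      Γ i i + (2 * t) • Γ i j + (t * t) • Γ j j =
        c • (EuclideanSpace.single i (1 : ℝ) + t • EuclideanSpace.single j (1 : ℝ)) := by
    intro i j t
    obtain ⟨c, hc⟩ := h (EuclideanSpace.single i (1 : ℝ) + t • EuclideanSpace.single j (1 : ℝ))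
    refine ⟨c, ?_⟩
    rw [← hc]
    simp only [PiLp.add_apply, PiLp.smul_apply, PiLp.single_apply, smul_eq_mul, add_mul, mul_add,
      add_smul, Finset.sum_add_distrib, mul_ite, ite_mul, mul_one, mul_zero, one_mul, zero_mul,
      ite_smul, zero_smul, one_smul, Finset.sum_ite_eq', Finset.mem_univ, if_true]
    rw [hsymm j i]
    module
  choose l hl using fun i => hQ i i 0
  have hdiag : ∀ i, Γ i i = l i • EuclideanSpace.single i (1 : ℝ) := fun i => by simpa using hl i
  -- The factor `1/2` comes from the diagonal, where the two terms coincide: `Γ_ii = 2 a_i e_i`.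
  refine ⟨fun i => l i / 2, fun i j => ?_⟩
  by_cases hij : i = j
  · subst hij
    rw [hdiag, ← add_smul]
    ring_nf
  · obtain ⟨c, hc⟩ := hQ i j 1
    obtain ⟨c', hc'⟩ := hQ i j (-1)
    rw [hdiag i, hdiag j] at hc hc'
    have e : ∀ k, _ := fun k => congrArg (fun v : E d => v k) hc
    have e' : ∀ k, _ := fun k => congrArg (fun v : E d => v k) hc'
    simp only [PiLp.add_apply, PiLp.smul_apply, PiLp.single_apply, smul_eq_mul] at e e'
    ext k
    simp only [PiLp.add_apply, PiLp.smul_apply, PiLp.single_apply, smul_eq_mul]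
    have ei := e i
    have ej := e j
    have ei' := e' i
    have ej' := e' j
    have ek := e k
    simp only [if_true, hij, Ne.symm hij, if_false] at ei ej ei' ej'
    by_cases hki : k = i
    · subst hki
      simp only [if_true, hij, if_false]
      linarith
    · by_cases hkj : k = j
      · subst hkj
        simp only [if_true, hki, if_false]
        linarith
      · simp only [hki, hkj, if_false] at ek ⊢
        linarith

end ProjectiveAlgebra

/-! ### Both curvature signs at once; the Christoffel symbols of `∇` in `ξ` -/

section SignedPotentials

variable {d : ℕ} {M : Type*} [TopologicalSpace M] [ChartedSpace (E d) M] [IsManifold (𝓡 d) ∞ M]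

/-- The bilinear form `D²φ + α Dφ ⊗ Dφ`. -/
noncomputable def expHessian (α : ℝ) (φ : E d → ℝ) (x : E d) : E d →L[ℝ] E d →L[ℝ] ℝ :=
  fderiv ℝ (fderiv ℝ φ) x + (α • fderiv ℝ φ x).smulRight (fderiv ℝ φ x)

theorem expHessian_apply (α : ℝ) (φ : E d → ℝ) (x a b : E d) :
    expHessian α φ x a b =
      fderiv ℝ (fderiv ℝ φ) x a b + α * fderiv ℝ φ x a * fderiv ℝ φ x b := by
  simp [expHessian]

namespace DualPotentials

variable {S : DualisticStructure d M} {α : ℝ}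

/-- The potentials give the metric, up to a common sign `s`. -/
structure IsSigned (P : DualPotentials S α) (s : ℝ) : Prop where
  sign : s * s = 1
  metric_ξ : ∀ p ∈ P.ξ.source, ∀ i j, metricCoeff S.g P.ξ i j p =
    s * (partialDeriv i (partialDeriv j P.φ) (P.ξ p)
      + α * partialDeriv i P.φ (P.ξ p) * partialDeriv j P.φ (P.ξ p))
  metric_η : ∀ p ∈ P.ξ.source, ∀ i j, metricCoeff S.g P.η i j p =
    s * (partialDeriv i (partialDeriv j P.ψ) (P.η p)
      + α * partialDeriv i P.ψ (P.η p) * partialDeriv j P.ψ (P.η p))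

theorem IsConcave.isSigned {P : DualPotentials S α} (h : P.IsConcave) : P.IsSigned (-1) where
  sign := by norm_num
  metric_ξ p hp i j := by rw [h.metric_ξ p hp]; ring
  metric_η p hp i j := by rw [h.metric_η p hp]; ring

theorem IsConvex.isSigned {P : DualPotentials S α} (h : P.IsConvex) : P.IsSigned 1 where
  sign := by norm_num
  metric_ξ p hp i j := by rw [h.metric_ξ p hp]; ring
  metric_η p hp i j := by rw [h.metric_η p hp]; ring

theorem contDiffAt_φ (P : DualPotentials S α) {p : M} (hp : p ∈ P.ξ.source) :
    ContDiffAt ℝ ∞ P.φ (P.ξ p) :=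
  P.smooth_φ.contDiffAt (P.ξ.open_target.mem_nhds (P.ξ.map_source hp))

theorem contDiffAt_two_φ (P : DualPotentials S α) {p : M} (hp : p ∈ P.ξ.source) :
    ContDiffAt ℝ 2 P.φ (P.ξ p) :=
  (P.contDiffAt_φ hp).of_le ENat.LEInfty.out

theorem IsSigned.inner_eq {P : DualPotentials S α} {s : ℝ} (h : P.IsSigned s) {p : M}
    (hp : p ∈ P.ξ.source) (u v : TangentSpace (𝓡 d) p) :
    S.g.inner p u v =
      s * expHessian α P.φ (P.ξ p) (chartDeriv P.ξ p u) (chartDeriv P.ξ p v) := by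
  have hb : ∀ i j, S.g.inner p (coordField P.ξ i p) (coordField P.ξ j p) =
      s * expHessian α P.φ (P.ξ p) (EuclideanSpace.single i 1) (EuclideanSpace.single j 1) := by
    intro i j
    rw [expHessian_apply, ← partialDeriv_partialDeriv (P.contDiffAt_two_φ hp)]
    exact h.metric_ξ p hp i j
  rw [ContinuousLinearMap.apply_apply_eq_sum_single]
  conv_lhs => rw [eq_sum_coordField P.ξ_mem hp v, map_sum]
  rw [Finset.mul_sum]
  refine Finset.sum_congr rfl fun j _ => ?_
  rw [map_smul, smul_eq_mul, mul_left_comm]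
  congr 1
  conv_lhs => rw [eq_sum_coordField P.ξ_mem hp u, map_sum, sum_apply]
  rw [Finset.mul_sum]
  refine Finset.sum_congr rfl fun i _ => ?_
  rw [map_smul, smul_apply, hb, smul_eq_mul]
  ring

theorem covariant_coordField_symm {cov : AffineConnection d M} (ht : cov.torsion = 0)
    {χ : OpenPartialHomeomorph M (E d)} (hχ : χ ∈ IsManifold.maximalAtlas (𝓡 d) ∞ M) {p : M}
    (hp : p ∈ χ.source) (i j : Fin d) :
    cov (coordField χ j) p (coordField χ i p) = cov (coordField χ i) p (coordField χ j p) := by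
  have := cov.torsion_eq_zero_iff.1 ht (mdifferentiableAt_coordField hχ hp i)
    (mdifferentiableAt_coordField hχ hp j)
  rw [mlieBracket_coordField hχ hp] at this
  exact sub_eq_zero.1 this

/-- The left side of the duality identity. Third derivatives of `φ` enter symmetrically, so they
drop out when two of its index orders are subtracted. -/
theorem IsSigned.mvfderiv_metricCoeff {P : DualPotentials S α} {s : ℝ} (h : P.IsSigned s) {p : M}
    (hp : p ∈ P.ξ.source) (i j k : Fin d) :
    mvfderiv (𝓡 d) (fun q => S.g.inner q (coordField P.ξ j q) (coordField P.ξ k q)) p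
        (coordField P.ξ i p) =
      s * (partialDeriv i (partialDeriv j (partialDeriv k P.φ)) (P.ξ p) + α *
        (partialDeriv i (partialDeriv j P.φ) (P.ξ p) * partialDeriv k P.φ (P.ξ p) +
          partialDeriv j P.φ (P.ξ p) * partialDeriv i (partialDeriv k P.φ) (P.ξ p))) := by
  have hφ := P.contDiffAt_φ hp
  have d1 : ∀ j, DifferentiableAt ℝ (partialDeriv j P.φ) (P.ξ p) := fun j =>
    (hφ.partialDeriv (m := ∞) (by simp) j).differentiableAt (by simp)
  have d2 : DifferentiableAt ℝ (partialDeriv j (partialDeriv k P.φ)) (P.ξ p) :=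
    ((hφ.partialDeriv (m := ∞) (by simp) k).partialDeriv (m := ∞) (by simp) j).differentiableAt
      (by simp)
  set f : E d → ℝ := fun x => s * (partialDeriv j (partialDeriv k P.φ) x +
    α * partialDeriv j P.φ x * partialDeriv k P.φ x) with hf
  have hfd : HasFDerivAt f (s • (fderiv ℝ (partialDeriv j (partialDeriv k P.φ)) (P.ξ p) +
      ((α * partialDeriv j P.φ (P.ξ p)) • fderiv ℝ (partialDeriv k P.φ) (P.ξ p) +
        partialDeriv k P.φ (P.ξ p) • (α • fderiv ℝ (partialDeriv j P.φ) (P.ξ p))))) (P.ξ p) :=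
    (d2.hasFDerivAt.add (((d1 j).hasFDerivAt.const_mul α).mul (d1 k).hasFDerivAt)).const_mul s
  have heq : (fun q => S.g.inner q (coordField P.ξ j q) (coordField P.ξ k q)) =ᶠ[𝓝 p] f ∘ P.ξ := by
    filter_upwards [P.ξ.open_source.mem_nhds hp] with q hq using h.metric_ξ q hq j k
  have hm : MDifferentiableAt (𝓡 d) 𝓘(ℝ, ℝ) (f ∘ P.ξ) p :=
    hfd.differentiableAt.comp_mdifferentiableAt
      ((chart_mdifferentiable P.ξ_mem).mdifferentiableAt hp)
  rw [mvfderiv, heq.mfderiv_eq]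
  change mvfderiv (𝓡 d) (f ∘ P.ξ) p (coordField P.ξ i p) = _
  rw [mvfderiv_coordField P.ξ_mem hp hm]
  have heq' : (f ∘ P.ξ) ∘ P.ξ.symm =ᶠ[𝓝 (P.ξ p)] f := by
    filter_upwards [P.ξ.open_target.mem_nhds (P.ξ.map_source hp)] with x hx
    simp [P.ξ.right_inv hx]
  rw [(heq'.partialDeriv i).eq_of_nhds, partialDeriv, hfd.fderiv]
  simp only [smul_apply, add_apply, smul_eq_mul]
  simp only [partialDeriv]
  ring

/-- The Christoffel symbols of the primal connection in the primal coordinates. -/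
theorem IsSigned.chartDeriv_primal {P : DualPotentials S α} {s : ℝ} (h : P.IsSigned s)
    (hd : 2 ≤ d) {p : M} (hp : p ∈ P.ξ.source) (i j : Fin d) :
    chartDeriv P.ξ p (S.primal (coordField P.ξ j) p (coordField P.ξ i p)) =
      (-(α • fderiv ℝ P.φ (P.ξ p))) (EuclideanSpace.single j 1) • EuclideanSpace.single i 1 +
        (-(α • fderiv ℝ P.φ (P.ξ p))) (EuclideanSpace.single i 1) • EuclideanSpace.single j 1 := by
  have hξ := P.ξ_mem
  have hΓ : ∀ i j, chartConnection S.primal P.ξ i j (P.ξ p) =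
      chartDeriv P.ξ p (S.primal (coordField P.ξ j) p (coordField P.ξ i p)) := by
    intro i j
    unfold chartConnection
    rw [P.ξ.left_inv hp]
  obtain ⟨a, ha⟩ := exists_eq_add_of_forall_smul
    (Γ := fun i j => chartConnection S.primal P.ξ i j (P.ξ p))
    (fun i j => by
      simp only [hΓ, covariant_coordField_symm S.torsion_primal hξ hp i j])
    (exists_smul_of_geodesicsAreStraight S.smooth_primal hξ P.straight_primal
      (P.ξ.map_source hp))
  simp only [hΓ] at ha
  have hcov : ∀ i j, S.primal (coordField P.ξ j) p (coordField P.ξ i p) =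
      a j • coordField P.ξ i p + a i • coordField P.ξ j p := by
    intro i j
    apply chartDeriv_injective hξ hp
    rw [ha, map_add, map_smul, map_smul, chartDeriv_coordField hξ hp, chartDeriv_coordField hξ hp]
  have hdual : ∀ i j k, mvfderiv (𝓡 d)
      (fun q => S.g.inner q (coordField P.ξ j q) (coordField P.ξ k q)) p (coordField P.ξ i p) =
      a j * metricCoeff S.g P.ξ i k p + a i * metricCoeff S.g P.ξ j k p +
        S.g.inner p (coordField P.ξ j p) (S.dual (coordField P.ξ k) p (coordField P.ξ i p)) := by
    intro i j k
    rw [S.duality P.ξ.source P.ξ.open_source _ _ _ (smoothFieldOn_coordField hξ j)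
      (smoothFieldOn_coordField hξ k) (smoothFieldOn_coordField hξ i) p hp, hcov]
    simp [metricCoeff]
  have hφ := P.contDiffAt_φ hp
  have hsymm : ∀ i j, metricCoeff S.g P.ξ i j p = metricCoeff S.g P.ξ j i p := fun i j =>
    S.g.symm p _ _
  have hss := h.sign
  -- The duality identity for `(i, j, k)` minus the one for `(k, j, i)`: the terms with `∇*` cancel
  -- because `∇*` is torsion-free, and second derivatives of `φ` are traded for metric coefficients.
  have key : ∀ i j k, (a i + α * partialDeriv i P.φ (P.ξ p)) * metricCoeff S.g P.ξ k j p =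
      (a k + α * partialDeriv k P.φ (P.ξ p)) * metricCoeff S.g P.ξ i j p := by
    intro i j k
    have e1 := hdual i j k
    have e2 := hdual k j i
    rw [h.mvfderiv_metricCoeff hp] at e1 e2
    rw [covariant_coordField_symm S.torsion_dual hξ hp k i] at e2
    rw [partialDeriv_left_comm hφ i j k, hsymm j k] at e1
    rw [partialDeriv_comm (P.contDiffAt_two_φ hp) k i, hsymm j i, hsymm k i] at e2
    have m1 := h.metric_ξ p hp i j
    have m2 := h.metric_ξ p hp k j
    linear_combination e2 - e1 + α * partialDeriv i P.φ (P.ξ p) * m2 -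
      α * partialDeriv k P.φ (P.ξ p) * m1
  have hzero : ∀ i, a i = -(α * partialDeriv i P.φ (P.ξ p)) := by
    intro i
    -- Here `d ≥ 2` enters: a second index is needed to separate `b i` from `b k`.
    obtain ⟨k, hk⟩ : ∃ k : Fin d, k ≠ i := by
      have : Nontrivial (Fin d) := Fin.nontrivial_iff_two_le.2 hd
      exact exists_ne i
    set b := fun i => a i + α * partialDeriv i P.φ (P.ξ p)
    -- By `key` this vector is orthogonal to every coordinate field, so it vanishes; independence of
    -- the fields `i` and `k` then gives `b i = 0`.
    have hvec : b i • coordField P.ξ k p - b k • coordField P.ξ i p = 0 := by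
      by_contra hne
      have hpos := S.g.pos p _ hne
      have hz : ∀ v, S.g.inner p (b i • coordField P.ξ k p - b k • coordField P.ξ i p) v = 0 := by
        intro v
        rw [eq_sum_coordField hξ hp v, map_sum]
        refine Finset.sum_eq_zero fun j _ => ?_
        have := key i j k
        simp only [metricCoeff] at this
        rw [map_smul, map_sub, map_smul, map_smul, sub_apply, smul_apply, smul_apply]
        simp only [smul_eq_mul, b]
        rw [this, sub_self, mul_zero]
      rw [hz] at hpos
      exact lt_irrefl _ hpos
    have := congrArg (fun v => chartDeriv P.ξ p v k) hvec
    simp only [map_sub, map_smul, chartDeriv_coordField hξ hp, map_zero] at this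
    simp [b, hk] at this
    linarith
  rw [ha, hzero, hzero]
  simp [partialDeriv]

end DualPotentials

end SignedPotentials

/-! ### Multiplication by `e^{αφ}` -/

section ExpMultiplication

variable {d : ℕ}

/-- The second derivative of `f e^{αφ}`. -/
theorem fderiv_fderiv_mul_exp {f φ : E d → ℝ} {x : E d} (hf : ContDiffAt ℝ 2 f x)
    (hφ : ContDiffAt ℝ 2 φ x) (α : ℝ) (a b : E d) :
    fderiv ℝ (fderiv ℝ (fun y => f y * Real.exp (α * φ y))) x a b =
      Real.exp (α * φ x) * (fderiv ℝ (fderiv ℝ f) x a b +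
        α * (fderiv ℝ φ x a * fderiv ℝ f x b + fderiv ℝ φ x b * fderiv ℝ f x a) +
        α * f x * expHessian α φ x a b) := by
  have hf1 : ∀ᶠ y in 𝓝 x, DifferentiableAt ℝ f y := by
    filter_upwards [hf.eventually (by simp)] with y hy using hy.differentiableAt two_ne_zero
  have hφ1 : ∀ᶠ y in 𝓝 x, DifferentiableAt ℝ φ y := by
    filter_upwards [hφ.eventually (by simp)] with y hy using hy.differentiableAt two_ne_zero
  have hf2 : DifferentiableAt ℝ (fderiv ℝ f) x :=
    (hf.fderiv_right (m := 1) (by norm_num)).differentiableAt one_ne_zero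
  have hφ2 : DifferentiableAt ℝ (fderiv ℝ φ) x :=
    (hφ.fderiv_right (m := 1) (by norm_num)).differentiableAt one_ne_zero
  have hexp : ∀ y, DifferentiableAt ℝ φ y → HasFDerivAt (fun y => Real.exp (α * φ y))
      (Real.exp (α * φ y) • (α • fderiv ℝ φ y)) y := fun y hy =>
    (hy.hasFDerivAt.const_mul α).exp
  have h1 : fderiv ℝ (fun y => f y * Real.exp (α * φ y)) =ᶠ[𝓝 x] fun y =>
      Real.exp (α * φ y) • (fderiv ℝ f y + (α * f y) • fderiv ℝ φ y) := by
    filter_upwards [hf1, hφ1] with y hy hy'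
    rw [(hy.hasFDerivAt.fun_mul (hexp y hy')).fderiv]
    module
  have hfx := hf1.self_of_nhds.hasFDerivAt
  have hφx := hφ1.self_of_nhds
  have h2 := (hexp x hφx).smul (hf2.hasFDerivAt.add ((hfx.const_mul α).smul hφ2.hasFDerivAt))
  rw [(h1.trans (Filter.EventuallyEq.refl _ _)).fderiv_eq]
  rw [show (fun y => Real.exp (α * φ y) • (fderiv ℝ f y + (α * f y) • fderiv ℝ φ y)) =
    ((fun y => Real.exp (α * φ y)) • (fderiv ℝ f + (fun y => α * f y) • fderiv ℝ φ)) from rfl,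
    h2.fderiv, expHessian_apply]
  simp
  ring

end ExpMultiplication

/-! ### The Hessian equation for the exponential of the divergence -/

section Potentials

variable {d : ℕ} {M : Type*} [TopologicalSpace M] [ChartedSpace (E d) M] [IsManifold (𝓡 d) ∞ M]

namespace DualPotentials

variable {S : DualisticStructure d M} {α : ℝ}

theorem IsSigned.covHessian_eq {P : DualPotentials S α} {s : ℝ} (h : P.IsSigned s)
    (hd : 2 ≤ d) {p : M} (hp : p ∈ P.ξ.source) {f : M → ℝ}
    (hf : ContMDiffAt (𝓡 d) 𝓘(ℝ, ℝ) 2 f p) {Y : ∀ x : M, TangentSpace (𝓡 d) x}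
    (hY : MDifferentiableAt (𝓡 d) (𝓡 d).tangent (fun x => (⟨x, Y x⟩ : TangentBundle (𝓡 d) M)) p)
    (u : TangentSpace (𝓡 d) p) :
    covHessian S.primal f Y p u =
      fderiv ℝ (fderiv ℝ (f ∘ P.ξ.symm)) (P.ξ p) (chartDeriv P.ξ p u) (chartDeriv P.ξ p (Y p)) +
        α * (fderiv ℝ P.φ (P.ξ p) (chartDeriv P.ξ p u) *
            fderiv ℝ (f ∘ P.ξ.symm) (P.ξ p) (chartDeriv P.ξ p (Y p)) +
          fderiv ℝ P.φ (P.ξ p) (chartDeriv P.ξ p (Y p)) *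
            fderiv ℝ (f ∘ P.ξ.symm) (P.ξ p) (chartDeriv P.ξ p u)) := by
  rw [covHessian_eq_of_projective P.ξ_mem hp (h.chartDeriv_primal hd hp) hf hY]
  simp only [neg_apply, smul_apply, smul_eq_mul]
  ring

/-- The equation `∇²f = -k f g` says that `f e^{αφ}` is affine in the primal coordinates. -/
theorem IsSigned.covHessian_add_eq {P : DualPotentials S α} {s : ℝ} (h : P.IsSigned s)
    (hd : 2 ≤ d) {p : M} (hp : p ∈ P.ξ.source) {f : M → ℝ}
    (hf : ContMDiffAt (𝓡 d) 𝓘(ℝ, ℝ) 2 f p) {Y : ∀ x : M, TangentSpace (𝓡 d) x}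
    (hY : MDifferentiableAt (𝓡 d) (𝓡 d).tangent (fun x => (⟨x, Y x⟩ : TangentBundle (𝓡 d) M)) p)
    (u : TangentSpace (𝓡 d) p) :
    Real.exp (α * P.φ (P.ξ p)) *
        (covHessian S.primal f Y p u + s * α * f p * S.g.inner p u (Y p)) =
      fderiv ℝ (fderiv ℝ (fun x => (f ∘ P.ξ.symm) x * Real.exp (α * P.φ x))) (P.ξ p)
        (chartDeriv P.ξ p u) (chartDeriv P.ξ p (Y p)) := by
  have hf' := contDiffAt_comp_chart_symm P.ξ_mem hp ENat.LEInfty.out hf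
  rw [fderiv_fderiv_mul_exp hf' (P.contDiffAt_two_φ hp), h.covHessian_eq hd hp hf hY,
    h.inner_eq hp]
  simp only [Function.comp_apply, P.ξ.left_inv hp]
  -- The sign occurs twice, in the curvature `s α` and in the metric, so only `s * s = 1` matters.
  linear_combination (Real.exp (α * P.φ (P.ξ p)) * α * f p * expHessian α P.φ (P.ξ p)
    (chartDeriv P.ξ p u) (chartDeriv P.ξ p (Y p))) * h.sign

/-- The exponential `(1 + α ξ_q · η_p) e^{-αφ(ξ_q) - αψ(η_p)}` of the divergence. -/
noncomputable def expDivergence (P : DualPotentials S α) (q p : M) : ℝ :=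
  (1 + α * inner ℝ (P.ξ q) (P.η p)) *
    (Real.exp (-(α * P.φ (P.ξ q))) * Real.exp (-(α * P.ψ (P.η p))))

theorem contMDiffAt_ξ (P : DualPotentials S α) {q : M} (hq : q ∈ P.ξ.source) :
    ContMDiffAt (𝓡 d) 𝓘(ℝ, E d) ∞ P.ξ q :=
  contMDiffAt_of_mem_maximalAtlas P.ξ_mem hq

theorem contMDiffAt_expDivergence (P : DualPotentials S α) {q : M} (hq : q ∈ P.ξ.source) (p : M) :
    ContMDiffAt (𝓡 d) 𝓘(ℝ, ℝ) ∞ (fun q => P.expDivergence q p) q := by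
  have hφ := P.contDiffAt_φ hq
  have : ContDiffAt ℝ ∞ (fun x => (1 + α * inner ℝ x (P.η p)) *
      (Real.exp (-(α * P.φ x)) * Real.exp (-(α * P.ψ (P.η p))))) (P.ξ q) := by
    have h1 : ContDiffAt ℝ ∞ (fun x : E d => inner ℝ x (P.η p)) (P.ξ q) :=
      contDiffAt_id.inner ℝ contDiffAt_const
    exact (contDiffAt_const.add (contDiffAt_const.mul h1)).mul
      ((contDiffAt_const.mul hφ).neg.exp.mul contDiffAt_const)
  exact this.comp_contMDiffAt (P.contMDiffAt_ξ hq)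

/-- The factor `e^{αφ}` cancels the only part that is not affine in `ξ`, leaving `e^{-αψ(η_p)} (1 +
α ξ · η_p)`. -/
theorem fderiv_fderiv_expDivergence (P : DualPotentials S α) {q : M} (hq : q ∈ P.ξ.source) (p : M) :
    fderiv ℝ (fderiv ℝ (fun x => ((fun q => P.expDivergence q p) ∘ P.ξ.symm) x *
      Real.exp (α * P.φ x))) (P.ξ q) = 0 := by
  set L : E d →L[ℝ] ℝ := (Real.exp (-(α * P.ψ (P.η p))) * α) • innerSL ℝ (P.η p) with hL
  have heq : (fun x => ((fun q => P.expDivergence q p) ∘ P.ξ.symm) x * Real.exp (α * P.φ x))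
      =ᶠ[𝓝 (P.ξ q)] fun x => Real.exp (-(α * P.ψ (P.η p))) + L x := by
    filter_upwards [P.ξ.open_target.mem_nhds (P.ξ.map_source hq)] with x hx
    simp only [expDivergence, Function.comp_apply, P.ξ.right_inv hx, hL, smul_apply,
      innerSL_apply_apply, smul_eq_mul]
    rw [real_inner_comm, Real.exp_neg (α * P.φ x)]
    field_simp
  have h1 : fderiv ℝ (fun x : E d => Real.exp (-(α * P.ψ (P.η p))) + L x) = fun _ => L := by
    ext1 x
    exact (L.hasFDerivAt.const_add _).fderiv
  rw [heq.fderiv.fderiv_eq, h1]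
  simp

/-- The equation `∇²f + k f g = 0` contains no coordinates or potentials, so it can be transferred
from one choice to another. -/
theorem IsSigned.covHessian_expDivergence {P : DualPotentials S α} {s : ℝ} (h : P.IsSigned s)
    (hd : 2 ≤ d) {q : M} (hq : q ∈ P.ξ.source) (p : M) {Y : ∀ x : M, TangentSpace (𝓡 d) x}
    (hY : MDifferentiableAt (𝓡 d) (𝓡 d).tangent (fun x => (⟨x, Y x⟩ : TangentBundle (𝓡 d) M)) q)
    (u : TangentSpace (𝓡 d) q) :
    covHessian S.primal (fun q => P.expDivergence q p) Y q u +
      s * α * P.expDivergence q p * S.g.inner q u (Y q) = 0 := by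
  have := h.covHessian_add_eq hd hq
    ((P.contMDiffAt_expDivergence hq p).of_le ENat.LEInfty.out) hY u
  rw [P.fderiv_fderiv_expDivergence hq p] at this
  simpa using this

end DualPotentials

end Potentials

/-! ### Independence of coordinates and potentials -/

section Independence

variable {d : ℕ} {M : Type*} [TopologicalSpace M] [ChartedSpace (E d) M] [IsManifold (𝓡 d) ∞ M]

namespace DualPotentials

variable {S : DualisticStructure d M} {α : ℝ}

theorem inner_gradient_eq_fderiv (φ : E d → ℝ) (x y : E d) :
    inner ℝ (gradient φ x) y = fderiv ℝ φ x y := by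
  simp [gradient]

theorem inner_η (P : DualPotentials S α) {p : M} (hp : p ∈ P.ξ.source) (x : E d) :
    inner ℝ x (P.η p) =
      (1 / (1 - α * fderiv ℝ P.φ (P.ξ p) (P.ξ p))) * fderiv ℝ P.φ (P.ξ p) x := by
  rw [P.dual_eq p hp, alphaGradient, inner_smul_right, inner_gradient_eq_fderiv, real_inner_comm,
    inner_gradient_eq_fderiv]

/-- Since `η_p` is the `α`-gradient of `φ` at `ξ_p`, the affine function `x ↦ 1 + α x · η_p` is
proportional to the tangent of `e^{αφ}` at `ξ_p`. -/
theorem one_add_inner_η (P : DualPotentials S α) {p : M} (hp : p ∈ P.ξ.source) (x : E d) :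
    1 + α * inner ℝ x (P.η p) = (1 + α * inner ℝ (P.ξ p) (P.η p)) *
      (1 + α * fderiv ℝ P.φ (P.ξ p) (x - P.ξ p)) := by
  have hA := P.gradient_pos p hp
  rw [inner_gradient_eq_fderiv] at hA
  rw [P.inner_η hp, P.inner_η hp, map_sub]
  field_simp
  ring

theorem exp_neg_ψ (hα : 0 < α) (P : DualPotentials S α) {p : M} (hp : p ∈ P.ξ.source) :
    Real.exp (-(α * P.ψ (P.η p))) =
      Real.exp (α * P.φ (P.ξ p)) / (1 + α * inner ℝ (P.ξ p) (P.η p)) := by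
  have hc := P.constraint p hp
  have hf := P.fenchel p hp
  rw [logCost] at hf
  have : -(α * P.ψ (P.η p)) =
      α * P.φ (P.ξ p) - Real.log (1 + α * inner ℝ (P.ξ p) (P.η p)) := by
    field_simp at hf
    linarith
  rw [this, Real.exp_sub, Real.exp_log hc]

/-- The Fenchel identity removes `ψ` and the `α`-gradient removes `η`. What remains is the tangent
of `e^{αφ}` at `ξ_p`, evaluated at `ξ_q`, over `e^{αφ(ξ_q)}`. -/
theorem expDivergence_eq (hα : 0 < α) (P : DualPotentials S α) (q : M) {p : M}
    (hp : p ∈ P.ξ.source) :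
    P.expDivergence q p = (1 + α * fderiv ℝ P.φ (P.ξ p) (P.ξ q - P.ξ p)) *
      Real.exp (α * P.φ (P.ξ p)) * Real.exp (-(α * P.φ (P.ξ q))) := by
  have hc := P.constraint p hp
  rw [expDivergence, P.one_add_inner_η hp, P.exp_neg_ψ hα hp]
  field_simp

theorem expDivergence_self (hα : 0 < α) (P : DualPotentials S α) {p : M} (hp : p ∈ P.ξ.source) :
    P.expDivergence p p = 1 := by
  rw [P.expDivergence_eq hα p hp, Real.exp_neg, sub_self, map_zero]
  field_simp
  simp

/-- A function and its tangent agree to first order, so their quotient is stationary. -/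
theorem mvfderiv_expDivergence_self (hα : 0 < α) (P : DualPotentials S α) {p : M}
    (hp : p ∈ P.ξ.source) : mvfderiv (𝓡 d) (fun q => P.expDivergence q p) p = 0 := by
  ext v
  rw [mvfderiv_eq_fderiv_chart P.ξ_mem hp
    ((P.contMDiffAt_expDivergence hp p).mdifferentiableAt (by simp))]
  set x₀ := P.ξ p
  set L := fderiv ℝ P.φ x₀
  have heq : (fun q => P.expDivergence q p) ∘ P.ξ.symm =ᶠ[𝓝 x₀] fun x =>
      (1 + α * L (x - x₀)) * Real.exp (α * P.φ x₀) * Real.exp (-(α * P.φ x)) := by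
    filter_upwards [P.ξ.open_target.mem_nhds (P.ξ.map_source hp)] with x hx
    rw [Function.comp_apply, P.expDivergence_eq hα _ hp, P.ξ.right_inv hx]
  have hφ : HasFDerivAt P.φ L x₀ :=
    ((P.contDiffAt_φ hp).differentiableAt (by simp)).hasFDerivAt
  have hL : HasFDerivAt (fun x => L (x - x₀)) L x₀ :=
    L.hasFDerivAt.comp x₀ ((hasFDerivAt_id x₀).sub_const x₀)
  have h1 := (((hL.const_mul α).const_add 1).mul_const (Real.exp (α * P.φ x₀))).fun_mul
    (hφ.const_mul α).fun_neg.exp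
  rw [heq.fderiv_eq, h1.fderiv]
  simp
  ring

/-- `expDivergence` makes sense without admissibility and detects it by its sign; uniqueness for it
therefore settles admissibility too. -/
theorem admissible_iff (P : DualPotentials S α) {q p : M} (hq : q ∈ P.ξ.source)
    (hp : p ∈ P.ξ.source) : P.Admissible q p ↔ 0 < P.expDivergence q p := by
  rw [Admissible, expDivergence,
    mul_pos_iff_of_pos_right (mul_pos (Real.exp_pos _) (Real.exp_pos _))]
  exact ⟨fun h => h.2.2, fun h => ⟨hq, hp, h⟩⟩

theorem divergence_eq_log (hα : 0 < α) (P : DualPotentials S α) {q p : M}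
    (h : P.Admissible q p) : P.divergence q p = 1 / α * Real.log (P.expDivergence q p) := by
  rw [divergence, expDivergence, Real.log_mul h.2.2.ne' (by positivity),
    Real.log_mul (by positivity) (by positivity), Real.log_exp, Real.log_exp]
  field_simp
  ring

theorem divergenceNeg_eq (P : DualPotentials S α) (q p : M) :
    P.divergenceNeg q p = - P.divergence q p := by
  rw [divergenceNeg, divergence]
  ring

/-- The function `f e^{αφ}` in the primal coordinates. -/
noncomputable def weighted (P : DualPotentials S α) (f : M → ℝ) (x : E d) : ℝ :=
  (f ∘ P.ξ.symm) x * Real.exp (α * P.φ x)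

theorem contDiffAt_weighted (P : DualPotentials S α) {f : M → ℝ} {q : M} (hq : q ∈ P.ξ.source)
    (hf : ContMDiffAt (𝓡 d) 𝓘(ℝ, ℝ) 2 f q) : ContDiffAt ℝ 2 (P.weighted f) (P.ξ q) :=
  (contDiffAt_comp_chart_symm P.ξ_mem hq ENat.LEInfty.out hf).mul
    (contDiffAt_const.mul (P.contDiffAt_two_φ hq)).exp

/-- The function of `P'` solves the invariant equation, which in the coordinates of `P` says that
its product with `e^{αφ}` is locally affine. -/
theorem IsSigned.fderiv_fderiv_weighted {P P' : DualPotentials S α} {s : ℝ} (h : P.IsSigned s)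
    (h' : P'.IsSigned s) (hd : 2 ≤ d) {q : M} (hq : q ∈ P.ξ.source) (hq' : q ∈ P'.ξ.source)
    (p : M) :
    fderiv ℝ (fderiv ℝ (P.weighted (fun q => P'.expDivergence q p))) (P.ξ q) = 0 := by
  ext a b
  rw [ContinuousLinearMap.apply_apply_eq_sum_single]
  refine Finset.sum_eq_zero fun j _ => mul_eq_zero_of_right _ (Finset.sum_eq_zero fun i _ => ?_)
  have hj := mdifferentiableAt_coordField P.ξ_mem hq j
  have := h.covHessian_add_eq hd hq
    ((P'.contMDiffAt_expDivergence hq' p).of_le ENat.LEInfty.out) hj (coordField P.ξ i q)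
  rw [h'.covHessian_expDivergence hd hq' p hj, chartDeriv_coordField P.ξ_mem hq,
    chartDeriv_coordField P.ξ_mem hq, mul_zero] at this
  exact mul_eq_zero_of_right _ this.symm

theorem fderiv_weighted_of_mvfderiv_eq_zero (P : DualPotentials S α) {f : M → ℝ} {p : M}
    (hp : p ∈ P.ξ.source) (hf : ContMDiffAt (𝓡 d) 𝓘(ℝ, ℝ) 2 f p)
    (hf0 : mvfderiv (𝓡 d) f p = 0) :
    fderiv ℝ (P.weighted f) (P.ξ p) = f p • fderiv ℝ (fun x => Real.exp (α * P.φ x)) (P.ξ p) := by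
  have h0 : fderiv ℝ (f ∘ P.ξ.symm) (P.ξ p) = 0 := by
    ext a
    obtain ⟨v, rfl⟩ := (chart_mdifferentiable P.ξ_mem).mfderiv_surjective hp a
    have := mvfderiv_eq_fderiv_chart P.ξ_mem hp (hf.mdifferentiableAt two_ne_zero) v
    rw [hf0] at this
    exact this.symm
  have h1 := ((contDiffAt_comp_chart_symm P.ξ_mem hp ENat.LEInfty.out hf).differentiableAt
    two_ne_zero).hasFDerivAt
  have h2 := ((contDiffAt_const.mul (P.contDiffAt_two_φ hp)).exp.differentiableAt (𝕜 := ℝ)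
    (f := fun x => Real.exp (α * P.φ x)) two_ne_zero).hasFDerivAt
  unfold weighted
  rw [(h1.fun_mul h2).fderiv, h0, smul_zero, add_zero, Function.comp_apply, P.ξ.left_inv hp]

theorem weighted_congr (P : DualPotentials S α) {f f' : M → ℝ} {q : M} (hq : q ∈ P.ξ.source)
    (h : f =ᶠ[𝓝 q] f') : P.weighted f =ᶠ[𝓝 (P.ξ q)] P.weighted f' := by
  have := (P.ξ.continuousAt_symm (P.ξ.map_source hq)).eventually (by rwa [P.ξ.left_inv hq])
  filter_upwards [this] with x hx
  simp only [weighted, Function.comp_apply, hx]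

theorem eq_of_weighted_eq (P : DualPotentials S α) {f f' : M → ℝ} {q : M} (hq : q ∈ P.ξ.source)
    (h : P.weighted f (P.ξ q) = P.weighted f' (P.ξ q)) : f q = f' q := by
  simp only [weighted, Function.comp_apply, P.ξ.left_inv hq] at h
  exact mul_right_cancel₀ (Real.exp_pos _).ne' h

/-- Uniqueness for `∇²f + k f g = 0` with value `1` and differential `0` at `p`, propagated along
the connected set `W`. -/
theorem IsSigned.expDivergence_unique {P P' : DualPotentials S α} {s : ℝ} (h : P.IsSigned s)
    (h' : P'.IsSigned s) (hα : 0 < α) (hd : 2 ≤ d) {W : Set M} (hW : IsOpen W)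
    (hWc : IsPreconnected W) (hWs : W ⊆ P.ξ.source ∩ P'.ξ.source) {q p : M} (hq : q ∈ W)
    (hp : p ∈ W) : P.expDivergence q p = P'.expDivergence q p := by
  set f := fun q => P.expDivergence q p
  set f' := fun q => P'.expDivergence q p
  have hf : ∀ q ∈ W, ContMDiffAt (𝓡 d) 𝓘(ℝ, ℝ) 2 f q := fun q hq =>
    (P.contMDiffAt_expDivergence (hWs hq).1 p).of_le ENat.LEInfty.out
  have hf' : ∀ q ∈ W, ContMDiffAt (𝓡 d) 𝓘(ℝ, ℝ) 2 f' q := fun q hq =>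
    (P'.contMDiffAt_expDivergence (hWs hq).2 p).of_le ENat.LEInfty.out
  -- On a coordinate ball both weighted functions are affine, so equal value and derivative at any
  -- one point `q₁` give equality on the whole ball.
  have hpropagate : ∀ q₀ ∈ W, ∃ N ∈ 𝓝 q₀, ∀ q₁ ∈ N,
      P.weighted f (P.ξ q₁) = P.weighted f' (P.ξ q₁) →
      fderiv ℝ (P.weighted f) (P.ξ q₁) = fderiv ℝ (P.weighted f') (P.ξ q₁) →
      ∀ q ∈ N, f q = f' q := by
    intro q₀ hq₀
    have hq₀s := (hWs hq₀).1
    have hmem : P.ξ.target ∩ P.ξ.symm ⁻¹' W ∈ 𝓝 (P.ξ q₀) := by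
      refine (P.ξ.symm.isOpen_inter_preimage hW).mem_nhds ⟨P.ξ.map_source hq₀s, ?_⟩
      rwa [Set.mem_preimage, P.ξ.left_inv hq₀s]
    obtain ⟨r, hr, hball⟩ := Metric.mem_nhds_iff.1 hmem
    have hsymm : ∀ x ∈ Metric.ball (P.ξ q₀) r, ∃ q ∈ W, P.ξ q = x := fun x hx =>
      ⟨P.ξ.symm x, (hball hx).2, P.ξ.right_inv (hball hx).1⟩
    have hconv : IsPreconnected (Metric.ball (P.ξ q₀) r) := (convex_ball _ _).isPreconnected
    have hsmooth : ∀ g : M → ℝ, (∀ q ∈ W, ContMDiffAt (𝓡 d) 𝓘(ℝ, ℝ) 2 g q) →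
        ContDiffOn ℝ 2 (P.weighted g) (Metric.ball (P.ξ q₀) r) := by
      intro g hg x hx
      obtain ⟨q, hq, rfl⟩ := hsymm x hx
      exact (P.contDiffAt_weighted (hWs hq).1 (hg q hq)).contDiffWithinAt
    refine ⟨P.ξ.source ∩ P.ξ ⁻¹' Metric.ball (P.ξ q₀) r,
      Filter.inter_mem (P.ξ.open_source.mem_nhds hq₀s)
        ((P.ξ.continuousAt hq₀s).preimage_mem_nhds (Metric.ball_mem_nhds _ hr)), ?_⟩
    intro q₁ hq₁ e0 e1 q hq
    have hconst : ∀ g : M → ℝ, (∀ q ∈ W, ContMDiffAt (𝓡 d) 𝓘(ℝ, ℝ) 2 g q) →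
        (∀ q ∈ W, fderiv ℝ (fderiv ℝ (P.weighted g)) (P.ξ q) = 0) →
        ∀ x ∈ Metric.ball (P.ξ q₀) r,
          fderiv ℝ (P.weighted g) x = fderiv ℝ (P.weighted g) (P.ξ q₁) := by
      intro g hg hg2 x hx
      refine Metric.isOpen_ball.is_const_of_fderiv_eq_zero hconv
        (((hsmooth g hg).fderiv_of_isOpen (m := 1) Metric.isOpen_ball
          (by norm_num)).differentiableOn one_ne_zero) ?_ hx hq₁.2
      intro y hy
      obtain ⟨q, hq, rfl⟩ := hsymm y hy
      exact hg2 q hq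
    refine P.eq_of_weighted_eq hq.1 (Metric.isOpen_ball.eqOn_of_fderiv_eq hconv
      ((hsmooth f hf).differentiableOn two_ne_zero) ((hsmooth f' hf').differentiableOn two_ne_zero)
      (fun x hx => ?_) hq₁.2 e0 hq.2)
    rw [hconst f hf (fun q hq => h.fderiv_fderiv_weighted h hd (hWs hq).1 (hWs hq).1 p) x hx,
      hconst f' hf' (fun q hq => h.fderiv_fderiv_weighted h' hd (hWs hq).1 (hWs hq).2 p) x hx, e1]
  have hfp : f p = f' p :=
    (P.expDivergence_self hα (hWs hp).1).trans (P'.expDivergence_self hα (hWs hp).2).symm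
  -- The set of points near which `f` and `f'` agree is open, contains `p` by the common initial
  -- data, and is closed in `W` by `hpropagate`.
  have hu : W ⊆ {q | f =ᶠ[𝓝 q] f'} := by
    refine hWc.subset_of_closure_inter_subset isOpen_setOfPred_eventually_nhds ⟨p, hp, ?_⟩ ?_
    · obtain ⟨N, hN, hNp⟩ := hpropagate p hp
      filter_upwards [hN] with q hq
      refine hNp p (mem_of_mem_nhds hN) ?_ ?_ q hq
      · simp only [weighted, Function.comp_apply, P.ξ.left_inv (hWs hp).1, hfp]
      · rw [P.fderiv_weighted_of_mvfderiv_eq_zero (hWs hp).1 (hf p hp)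
            (P.mvfderiv_expDivergence_self hα (hWs hp).1),
          P.fderiv_weighted_of_mvfderiv_eq_zero (hWs hp).1 (hf' p hp)
            (P'.mvfderiv_expDivergence_self hα (hWs hp).2), hfp]
    · rintro q₀ ⟨hcl, hq₀⟩
      obtain ⟨N, hN, hNp⟩ := hpropagate q₀ hq₀
      obtain ⟨q₁, ⟨hq₁, hq₁W⟩, hq₁u⟩ := mem_closure_iff_nhds.1 hcl (N ∩ W)
        (Filter.inter_mem hN (hW.mem_nhds hq₀))
      have heq := P.weighted_congr (hWs hq₁W).1 hq₁u
      filter_upwards [hN] with q hq using hNp q₁ hq₁ heq.eq_of_nhds heq.fderiv_eq q hq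
  exact (hu hq).eq_of_nhds

theorem IsSigned.divergence_unique {P P' : DualPotentials S α} {s : ℝ} (h : P.IsSigned s)
    (h' : P'.IsSigned s) (hα : 0 < α) (hd : 2 ≤ d) {W : Set M} (hW : IsOpen W)
    (hWc : IsPreconnected W) (hWs : W ⊆ P.ξ.source ∩ P'.ξ.source) {q p : M} (hq : q ∈ W)
    (hp : p ∈ W) : (P.Admissible q p ↔ P'.Admissible q p) ∧
      (P.Admissible q p → P.divergence q p = P'.divergence q p) := by
  have he := h.expDivergence_unique h' hα hd hW hWc hWs hq hp
  have hiff : P.Admissible q p ↔ P'.Admissible q p := by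
    rw [P.admissible_iff (hWs hq).1 (hWs hp).1, P'.admissible_iff (hWs hq).2 (hWs hp).2, he]
  refine ⟨hiff, fun ha => ?_⟩
  rw [P.divergence_eq_log hα ha, P'.divergence_eq_log hα (hiff.1 ha), he]

end DualPotentials

end Independence

/-! ### Strict convexity and tangents -/

section StrictConvexity

/-- A function with positive definite second derivative lies strictly above its tangents. -/
theorem tangent_lt_of_fderiv_fderiv_pos {V : Type*} [NormedAddCommGroup V] [NormedSpace ℝ V]
    {f : V → ℝ} {B : Set V} (hB : IsOpen B) (hBc : Convex ℝ B) (hf : ContDiffOn ℝ 2 f B)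
    (hpos : ∀ x ∈ B, ∀ a, a ≠ 0 → 0 < fderiv ℝ (fderiv ℝ f) x a a) {x y : V} (hx : x ∈ B)
    (hy : y ∈ B) (hne : y ≠ x) : f x + fderiv ℝ f x (y - x) < f y := by
  set w := y - x with hw
  have hw0 : w ≠ 0 := sub_ne_zero.2 hne
  have hmem : ∀ t ∈ Set.Icc (0 : ℝ) 1, x + t • w ∈ B := fun t ht =>
    hBc.add_smul_sub_mem hx hy ht
  have hline : ∀ t : ℝ, HasDerivAt (fun t : ℝ => x + t • w) w t := fun t => by
    simpa using ((hasDerivAt_id t).smul_const w).const_add x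
  have h1 : ∀ t ∈ Set.Icc (0 : ℝ) 1,
      HasDerivAt (fun t : ℝ => f (x + t • w)) (fderiv ℝ f (x + t • w) w) t := fun t ht =>
    HasFDerivAt.comp_hasDerivAt t ((hf.contDiffAt (hB.mem_nhds (hmem t ht))).differentiableAt
      two_ne_zero).hasFDerivAt (hline t)
  have h2 : ∀ t ∈ Set.Icc (0 : ℝ) 1, HasDerivAt (fun t : ℝ => fderiv ℝ f (x + t • w) w)
      (fderiv ℝ (fderiv ℝ f) (x + t • w) w w) t := fun t ht => by
    have hd : DifferentiableAt ℝ (fderiv ℝ f) (x + t • w) :=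
      ((hf.contDiffAt (hB.mem_nhds (hmem t ht))).fderiv_right (m := 1)
        (by norm_num)).differentiableAt one_ne_zero
    have := HasFDerivAt.comp_hasDerivAt t hd.hasFDerivAt (hline t)
    simpa using this.clm_apply (hasDerivAt_const t w)
  have hmono : StrictMonoOn (fun t : ℝ => fderiv ℝ f (x + t • w) w) (Set.Icc 0 1) := by
    refine strictMonoOn_of_deriv_pos (convex_Icc 0 1)
      (fun t ht => (h2 t ht).continuousAt.continuousWithinAt) fun t ht => ?_
    have ht' := interior_subset ht
    rw [(h2 t ht').deriv]
    exact hpos _ (hmem t ht') w hw0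
  -- The mean slope along the segment is the derivative at an interior point `c`, which exceeds the
  -- derivative at `0` by `hmono`.
  obtain ⟨c, hc, hslope⟩ := exists_hasDerivAt_eq_slope (fun t : ℝ => f (x + t • w))
    (fun t => fderiv ℝ f (x + t • w) w) one_pos
    (fun t ht => (h1 t ht).continuousAt.continuousWithinAt)
    (fun t ht => h1 t (Set.Ioo_subset_Icc_self ht))
  have hlt := hmono (Set.left_mem_Icc.2 zero_le_one) (Set.Ioo_subset_Icc_self hc) hc.1
  simp only [zero_smul, add_zero, one_smul, sub_zero, div_one] at hlt hslope
  rw [hslope, hw, add_sub_cancel] at hlt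
  linarith

end StrictConvexity

/-! ### Smoothness and positivity near the diagonal -/

section LocalDivergence

variable {d : ℕ} {M : Type*} [TopologicalSpace M] [ChartedSpace (E d) M] [IsManifold (𝓡 d) ∞ M]

namespace DualPotentials

variable {S : DualisticStructure d M} {α : ℝ}

/-- The divergence with the sign that makes it nonnegative. -/
noncomputable def signedDivergence (P : DualPotentials S α) (s : ℝ) (q p : M) : ℝ :=
  -s * P.divergence q p

theorem eventually_admissible (P : DualPotentials S α) {p : M} (hp : p ∈ P.ξ.source) :
    ∀ᶠ z : M × M in 𝓝 (p, p), P.Admissible z.1 z.2 := by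
  have hsrc : ∀ᶠ q in 𝓝 p, q ∈ P.ξ.source := P.ξ.open_source.mem_nhds hp
  have hη : ContinuousAt P.η p := P.η.continuousAt (P.source_eq ▸ hp)
  have hc : ContinuousAt (fun z : M × M => 1 + α * inner ℝ (P.ξ z.1) (P.η z.2)) (p, p) :=
    continuousAt_const.add (continuousAt_const.mul
      (((P.ξ.continuousAt hp).comp (x := (p, p)) continuousAt_fst).inner
        (hη.comp (x := (p, p)) continuousAt_snd)))
  filter_upwards [hc.eventually (lt_mem_nhds (P.constraint p hp)),
    continuousAt_fst.eventually hsrc, continuousAt_snd.eventually hsrc] with z h1 h2 h3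
  exact ⟨h2, h3, h1⟩

theorem contMDiffAt_divergence (P : DualPotentials S α) {p : M} (hp : p ∈ P.ξ.source) :
    ContMDiffAt ((𝓡 d).prod (𝓡 d)) 𝓘(ℝ, ℝ) ∞ (fun z : M × M => P.divergence z.1 z.2) (p, p) := by
  have hpη : p ∈ P.η.source := P.source_eq ▸ hp
  have hξ : ContMDiffAt ((𝓡 d).prod (𝓡 d)) 𝓘(ℝ, E d) ∞ (fun z : M × M => P.ξ z.1) (p, p) :=
    ContMDiffAt.comp (p, p) (P.contMDiffAt_ξ hp) contMDiffAt_fst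
  have hη : ContMDiffAt ((𝓡 d).prod (𝓡 d)) 𝓘(ℝ, E d) ∞ (fun z : M × M => P.η z.2) (p, p) :=
    ContMDiffAt.comp (p, p) (contMDiffAt_of_mem_maximalAtlas P.η_mem hpη) contMDiffAt_snd
  have hψ : ContDiffAt ℝ ∞ P.ψ (P.η p) :=
    P.smooth_ψ.contDiffAt (P.η.open_target.mem_nhds (P.η.map_source hpη))
  have h : ContDiffAt ℝ ∞ (fun w : E d × E d =>
      1 / α * Real.log (1 + α * inner ℝ w.1 w.2) - P.φ w.1 - P.ψ w.2) (P.ξ p, P.η p) := by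
    have h1 : ContDiffAt ℝ ∞ (fun w : E d × E d => 1 + α * inner ℝ w.1 w.2) (P.ξ p, P.η p) :=
      contDiffAt_const.add (contDiffAt_const.mul (contDiffAt_fst.inner ℝ contDiffAt_snd))
    refine ((contDiffAt_const.mul (h1.log (P.constraint p hp).ne')).sub ?_).sub ?_
    · exact ContDiffAt.comp (g := P.φ) (P.ξ p, P.η p) (P.contDiffAt_φ hp) contDiffAt_fst
    · exact ContDiffAt.comp (g := P.ψ) (P.ξ p, P.η p) hψ contDiffAt_snd
  exact ContDiffAt.comp_contMDiffAt (f := fun z : M × M => (P.ξ z.1, P.η z.2)) h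
    (hξ.prodMk_space hη)

/-- The function `s e^{αφ}` has second derivative `α e^{αφ} g`, so it lies strictly above its
tangent at `ξ_p`; division by `e^{αφ(ξ_q)}` gives the inequality. -/
theorem IsSigned.eventually_one_sub_expDivergence {P : DualPotentials S α} {s : ℝ}
    (h : P.IsSigned s) (hα : 0 < α) {p : M} (hp : p ∈ P.ξ.source) :
    ∀ᶠ z : M × M in 𝓝 (p, p), z.1 ≠ z.2 → 0 < s * (1 - P.expDivergence z.1 z.2) := by
  obtain ⟨r, hr, hball⟩ := Metric.isOpen_iff.1 P.ξ.open_target _ (P.ξ.map_source hp)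
  set f : E d → ℝ := fun x => s * Real.exp (α * P.φ x)
  have hφ : ∀ x ∈ Metric.ball (P.ξ p) r, ContDiffAt ℝ 2 P.φ x := fun x hx =>
    (P.smooth_φ.contDiffAt (P.ξ.open_target.mem_nhds (hball hx))).of_le ENat.LEInfty.out
  have hf : ContDiffOn ℝ 2 f (Metric.ball (P.ξ p) r) := fun x hx =>
    (contDiffAt_const.mul (contDiffAt_const.mul (hφ x hx)).exp).contDiffWithinAt
  have hpos : ∀ x ∈ Metric.ball (P.ξ p) r, ∀ a, a ≠ 0 → 0 < fderiv ℝ (fderiv ℝ f) x a a := by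
    intro x hx a ha
    set q := P.ξ.symm x
    have hq : q ∈ P.ξ.source := P.ξ.map_target (hball hx)
    have hqx : P.ξ q = x := P.ξ.right_inv (hball hx)
    obtain ⟨v, hv⟩ : ∃ v : TangentSpace (𝓡 d) q, chartDeriv P.ξ q v = a :=
      (chart_mdifferentiable P.ξ_mem).mfderiv_surjective hq a
    have hv0 : v ≠ 0 := by
      rintro rfl
      exact ha (by rw [← hv, map_zero])
    have hg := S.g.pos q v hv0
    rw [h.inner_eq hq, hqx, hv] at hg
    have he := fderiv_fderiv_mul_exp (f := fun _ => s) contDiffAt_const (hφ x hx) α a a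
    simp only [fderiv_fun_const, fderiv_zero, Pi.zero_apply, zero_apply, mul_zero, add_zero,
      zero_add] at he
    rw [he]
    have := mul_pos (mul_pos (Real.exp_pos (α * P.φ x)) hα) hg
    linarith
  have hmem : ∀ᶠ q in 𝓝 p, q ∈ P.ξ.source ∧ P.ξ q ∈ Metric.ball (P.ξ p) r :=
    Filter.Eventually.and (P.ξ.open_source.mem_nhds hp)
      ((P.ξ.continuousAt hp).eventually (Metric.ball_mem_nhds _ hr))
  filter_upwards [continuousAt_fst.eventually hmem, continuousAt_snd.eventually hmem]
    with z h1 h2 hne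
  have hlt := tangent_lt_of_fderiv_fderiv_pos Metric.isOpen_ball (convex_ball _ _) hf hpos h2.2 h1.2
    fun he => hne (P.ξ.injOn h1.1 h2.1 he)
  have hd : fderiv ℝ f (P.ξ z.2) =
      s • (Real.exp (α * P.φ (P.ξ z.2)) • (α • fderiv ℝ P.φ (P.ξ z.2))) :=
    ((((P.contDiffAt_φ h2.1).differentiableAt (by simp)).hasFDerivAt.const_mul α).exp.const_mul
      s).fderiv
  rw [hd] at hlt
  simp only [smul_apply, smul_eq_mul, f] at hlt
  rw [P.expDivergence_eq hα _ h2.1, Real.exp_neg]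
  have he := Real.exp_pos (α * P.φ (P.ξ z.1))
  rw [← mul_pos_iff_of_pos_right he]
  field_simp
  linarith

theorem IsSigned.isLocalDivergenceOn {P : DualPotentials S α} {s : ℝ} (h : P.IsSigned s)
    (hα : 0 < α) : IsLocalDivergenceOn d (P.signedDivergence s) P.ξ.source := by
  intro p hp
  refine ⟨contMDiffAt_const.mul (P.contMDiffAt_divergence hp), ?_⟩
  filter_upwards [P.eventually_admissible hp, h.eventually_one_sub_expDivergence hα hp]
    with z hadm hz
  have hpos := (P.admissible_iff hadm.1 hadm.2.1).1 hadm
  rw [signedDivergence, P.divergence_eq_log hα hadm]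
  by_cases he : z.1 = z.2
  · rw [he, P.expDivergence_self hα hadm.2.1]
    simp
  · have hlt : 0 < -s * (1 / α * Real.log (P.expDivergence z.1 z.2)) := by
      have hz := hz he
      have hα' : 0 < 1 / α := by positivity
      -- For `s = 1` the exponential is below `1`, for `s = -1` above; in both cases `-s log` of it
      -- is positive.
      rcases mul_self_eq_one_iff.1 h.sign with rfl | rfl
      · have := Real.log_neg hpos (by linarith)
        nlinarith
      · have := Real.log_pos (x := P.expDivergence z.1 z.2) (by linarith)
        nlinarith
    exact ⟨hlt.le, fun h0 => absurd h0 hlt.ne', fun h0 => absurd h0 he⟩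

end DualPotentials

end LocalDivergence

/-! ### The metric and the primal connection -/

section InducedGeometry

variable {d : ℕ} {M : Type*} [TopologicalSpace M] [ChartedSpace (E d) M] [IsManifold (𝓡 d) ∞ M]

theorem partialDeriv_fun_neg (i : Fin d) (f : E d → ℝ) :
    partialDeriv i (fun x => -f x) = fun x => -partialDeriv i f x := by
  ext x
  simp [partialDeriv, fderiv_fun_neg]

/-- The rational function `B(x - x₀) / (1 + L(x - x₀))`. -/
noncomputable def centeredQuotient (B L : E d →L[ℝ] ℝ) (x₀ x : E d) : ℝ :=
  B (x - x₀) * (1 + L (x - x₀))⁻¹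

theorem contDiffAt_centeredQuotient (B L : E d →L[ℝ] ℝ) (x₀ : E d) :
    ContDiffAt ℝ ∞ (centeredQuotient B L x₀) x₀ := by
  have h : ∀ K : E d →L[ℝ] ℝ, ContDiff ℝ ∞ (fun x => K (x - x₀)) := fun K =>
    K.contDiff.comp (contDiff_id.sub contDiff_const)
  exact (h B).contDiffAt.mul ((contDiffAt_const.add (h L).contDiffAt).inv (by simp))

theorem fderiv_centeredQuotient_eventuallyEq (B L : E d →L[ℝ] ℝ) (x₀ : E d) :
    fderiv ℝ (centeredQuotient B L x₀) =ᶠ[𝓝 x₀] fun x =>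
      (1 + L (x - x₀))⁻¹ • B - (B (x - x₀) * ((1 + L (x - x₀)) ^ 2)⁻¹) • L := by
  have hc : ContinuousAt (fun x => 1 + L (x - x₀)) x₀ := by fun_prop
  filter_upwards [hc.eventually_ne (y := 0) (by simp)] with x hx
  have h : ∀ K : E d →L[ℝ] ℝ, HasFDerivAt (fun x => K (x - x₀)) K x := fun K =>
    K.hasFDerivAt.comp x ((hasFDerivAt_id x).sub_const x₀)
  have hinv := (hasDerivAt_inv hx).comp_hasFDerivAt x ((h L).const_add 1)
  have := ((h B).fun_mul hinv).fderiv
  unfold centeredQuotient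
  refine this.trans ?_
  simp only [Function.comp_apply]
  module

theorem fderiv_centeredQuotient (B L : E d →L[ℝ] ℝ) (x₀ : E d) :
    fderiv ℝ (centeredQuotient B L x₀) x₀ = B := by
  rw [(fderiv_centeredQuotient_eventuallyEq B L x₀).eq_of_nhds]
  simp

/-- The symmetric product `-(L ⊗ B + B ⊗ L)` is what the Christoffel symbols of `∇` cancel when `L =
α dφ`. -/
theorem fderiv_fderiv_centeredQuotient (B L : E d →L[ℝ] ℝ) (x₀ a b : E d) :
    fderiv ℝ (fderiv ℝ (centeredQuotient B L x₀)) x₀ a b = -(L a * B b) - B a * L b := by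
  have h : ∀ K : E d →L[ℝ] ℝ, HasFDerivAt (fun x => K (x - x₀)) K x₀ := fun K =>
    K.hasFDerivAt.comp x₀ ((hasFDerivAt_id x₀).sub_const x₀)
  have h1 : (1 : ℝ) + L (x₀ - x₀) ≠ 0 := by simp
  have hinv := (hasDerivAt_inv h1).comp_hasFDerivAt x₀ ((h L).const_add 1)
  have hinv2 := (hasDerivAt_inv (pow_ne_zero 2 h1)).comp_hasFDerivAt x₀
    (((h L).const_add 1).pow 2)
  have := (hinv.smul_const B).fun_sub (((h B).fun_mul hinv2).smul_const L)
  rw [(fderiv_centeredQuotient_eventuallyEq B L x₀).fderiv_eq]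
  refine (congrArg (fun K : E d →L[ℝ] E d →L[ℝ] ℝ => K a b) this.fderiv).trans ?_
  simp

namespace DualPotentials

variable {S : DualisticStructure d M} {α : ℝ}

/-- The base point of the tangent is varied while `x` is fixed. Over the common denominator the
terms linear in `Dφ` cancel, and only `D²φ + α Dφ ⊗ Dφ` remains. -/
theorem hasFDerivAt_log_tangent {φ : E d → ℝ} {x₀ : E d} (hφ : ContDiffAt ℝ 2 φ x₀) (hα : 0 < α)
    {x : E d} (hx : 0 < 1 + α * fderiv ℝ φ x₀ (x - x₀)) :
    HasFDerivAt (fun x' => 1 / α * Real.log (1 + α * fderiv ℝ φ x' (x - x')) + φ x')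
      ((1 + α * fderiv ℝ φ x₀ (x - x₀))⁻¹ • (expHessian α φ x₀).flip (x - x₀)) x₀ := by
  have h1 : HasFDerivAt φ (fderiv ℝ φ x₀) x₀ := (hφ.differentiableAt two_ne_zero).hasFDerivAt
  have h2 : HasFDerivAt (fderiv ℝ φ) (fderiv ℝ (fderiv ℝ φ) x₀) x₀ :=
    ((hφ.fderiv_right (m := 1) (by norm_num)).differentiableAt one_ne_zero).hasFDerivAt
  have h3 := h2.clm_apply ((hasFDerivAt_id x₀).const_sub x)
  have h4 := ((((h3.const_mul α).const_add 1).log hx.ne').const_mul (1 / α)).add h1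
  refine h4.congr_fderiv ?_
  ext a
  have hx' : 1 + α * (fderiv ℝ φ x₀ x - fderiv ℝ φ x₀ x₀) ≠ 0 := by
    rw [← map_sub]
    exact hx.ne'
  simp [expHessian_apply]
  field_simp
  ring

theorem signedDivergence_eventuallyEq (hα : 0 < α) (P : DualPotentials S α) (s : ℝ) {q p : M}
    (h : P.Admissible q p) : P.signedDivergence s q =ᶠ[𝓝 p] (fun x' =>
      -s * ((1 / α * Real.log (1 + α * fderiv ℝ P.φ x' (P.ξ q - x')) + P.φ x') -
        P.φ (P.ξ q))) ∘ P.ξ := by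
  have hη : ContinuousAt P.η p := P.η.continuousAt (P.source_eq ▸ h.2.1)
  have hc : ContinuousAt (fun p' => 1 + α * inner ℝ (P.ξ q) (P.η p')) p :=
    continuousAt_const.add (continuousAt_const.mul (continuousAt_const.inner hη))
  filter_upwards [P.ξ.open_source.mem_nhds h.2.1, hc.eventually (lt_mem_nhds h.2.2)] with p' hp' hpos
  have hadm : P.Admissible q p' := ⟨h.1, hp', hpos⟩
  have hpos' := (P.admissible_iff h.1 hp').1 hadm
  rw [signedDivergence, P.divergence_eq_log hα hadm, P.expDivergence_eq hα _ hp']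
  rw [P.expDivergence_eq hα _ hp', mul_assoc] at hpos'
  have hpos'' := pos_of_mul_pos_left hpos' (by positivity)
  rw [Real.log_mul (by positivity) (by positivity), Real.log_mul (by positivity) (by positivity),
    Real.log_exp, Real.log_exp, Function.comp_apply]
  field_simp
  ring

/-- The formula is needed for all admissible `q`, not just `q = p`, because it is differentiated in
`q` afterwards. -/
theorem signedDivergence_snd (hα : 0 < α) (P : DualPotentials S α) (s : ℝ) {q p : M}
    (h : P.Admissible q p) :
    MDifferentiableAt (𝓡 d) 𝓘(ℝ, ℝ) (P.signedDivergence s q) p ∧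
      ∀ v, mvfderiv (𝓡 d) (P.signedDivergence s q) p v =
        -centeredQuotient (s • expHessian α P.φ (P.ξ p) (chartDeriv P.ξ p v))
          (α • fderiv ℝ P.φ (P.ξ p)) (P.ξ p) (P.ξ q) := by
  have hp := h.2.1
  have hx : 0 < 1 + α * fderiv ℝ P.φ (P.ξ p) (P.ξ q - P.ξ p) := by
    have := h.2.2
    rw [P.one_add_inner_η hp] at this
    exact pos_of_mul_pos_right this (P.constraint p hp).le
  have hD := ((hasFDerivAt_log_tangent (P.contDiffAt_two_φ hp) hα hx).sub_const
    (P.φ (P.ξ q))).const_mul (-s)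
  have heq := P.signedDivergence_eventuallyEq hα s h
  have hm := (hD.differentiableAt.comp_mdifferentiableAt
    ((chart_mdifferentiable P.ξ_mem).mdifferentiableAt hp)).congr_of_eventuallyEq heq
  refine ⟨hm, fun v => ?_⟩
  rw [mvfderiv_eq_fderiv_chart P.ξ_mem hp hm]
  have heq' : P.signedDivergence s q ∘ P.ξ.symm =ᶠ[𝓝 (P.ξ p)] fun x' =>
      -s * ((1 / α * Real.log (1 + α * fderiv ℝ P.φ x' (P.ξ q - x')) + P.φ x') -
        P.φ (P.ξ q)) := by
    have := (P.ξ.continuousAt_symm (P.ξ.map_source hp)).eventually (by rwa [P.ξ.left_inv hp])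
    filter_upwards [this, P.ξ.open_target.mem_nhds (P.ξ.map_source hp)] with x hx hxt
    rw [Function.comp_apply, hx, Function.comp_apply, P.ξ.right_inv hxt]
  rw [heq'.fderiv_eq, hD.fderiv]
  simp [centeredQuotient]
  ring

/-- `q ↦ -d(D[q : ·])_p(v)`, a function with differential `⟨·, v⟩` and vanishing Hessian at `p`. -/
noncomputable def sndDifferential (P : DualPotentials S α) (s : ℝ) (p : M)
    (v : TangentSpace (𝓡 d) p) (q : M) : ℝ :=
  centeredQuotient (s • expHessian α P.φ (P.ξ p) (chartDeriv P.ξ p v))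
    (α • fderiv ℝ P.φ (P.ξ p)) (P.ξ p) (P.ξ q)

theorem contMDiffAt_sndDifferential (P : DualPotentials S α) (s : ℝ) {p : M}
    (hp : p ∈ P.ξ.source) (v : TangentSpace (𝓡 d) p) :
    ContMDiffAt (𝓡 d) 𝓘(ℝ, ℝ) 2 (P.sndDifferential s p v) p :=
  ((contDiffAt_centeredQuotient _ _ _).comp_contMDiffAt (P.contMDiffAt_ξ hp)).of_le
    ENat.LEInfty.out

theorem sndDifferential_comp_symm (P : DualPotentials S α) (s : ℝ) {p : M}
    (hp : p ∈ P.ξ.source) (v : TangentSpace (𝓡 d) p) :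
    P.sndDifferential s p v ∘ P.ξ.symm =ᶠ[𝓝 (P.ξ p)]
      centeredQuotient (s • expHessian α P.φ (P.ξ p) (chartDeriv P.ξ p v))
        (α • fderiv ℝ P.φ (P.ξ p)) (P.ξ p) := by
  filter_upwards [P.ξ.open_target.mem_nhds (P.ξ.map_source hp)] with x hx
  rw [Function.comp_apply, sndDifferential, P.ξ.right_inv hx]

theorem IsSigned.mvfderiv_sndDifferential {P : DualPotentials S α} {s : ℝ} (h : P.IsSigned s)
    {p : M} (hp : p ∈ P.ξ.source) (u v : TangentSpace (𝓡 d) p) :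
    mvfderiv (𝓡 d) (P.sndDifferential s p v) p u = S.g.inner p u v := by
  rw [mvfderiv_eq_fderiv_chart P.ξ_mem hp
    ((P.contMDiffAt_sndDifferential s hp v).mdifferentiableAt two_ne_zero),
    (P.sndDifferential_comp_symm s hp v).fderiv_eq, fderiv_centeredQuotient, S.g.symm,
    h.inner_eq hp]
  simp

theorem IsSigned.covHessian_sndDifferential {P : DualPotentials S α} {s : ℝ} (h : P.IsSigned s)
    (hd : 2 ≤ d) {p : M} (hp : p ∈ P.ξ.source) (v : TangentSpace (𝓡 d) p)
    {Y : ∀ x : M, TangentSpace (𝓡 d) x}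
    (hY : MDifferentiableAt (𝓡 d) (𝓡 d).tangent (fun x => (⟨x, Y x⟩ : TangentBundle (𝓡 d) M)) p)
    (u : TangentSpace (𝓡 d) p) :
    covHessian S.primal (P.sndDifferential s p v) Y p u = 0 := by
  have he := P.sndDifferential_comp_symm s hp v
  rw [h.covHessian_eq hd hp (P.contMDiffAt_sndDifferential s hp v) hY, he.fderiv.fderiv_eq,
    he.fderiv_eq, fderiv_fderiv_centeredQuotient, fderiv_centeredQuotient]
  simp
  ring

theorem partialDeriv_signedDivergence_eventuallyEq (hα : 0 < α) (P : DualPotentials S α) (s : ℝ)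
    {χ : OpenPartialHomeomorph M (E d)} (hχ : χ ∈ IsManifold.maximalAtlas (𝓡 d) ∞ M) {p : M}
    (hpχ : p ∈ χ.source) (hp : p ∈ P.ξ.source) (k : Fin d) :
    (fun x => partialDeriv k (fun y => P.signedDivergence s (χ.symm x) (χ.symm y)) (χ p))
      =ᶠ[𝓝 (χ p)]
      fun x => -(P.sndDifferential s p (coordField χ k p) ∘ χ.symm) x := by
  have hc : Filter.Tendsto (fun x => (χ.symm x, p)) (𝓝 (χ p)) (𝓝 (p, p)) := by
    have := χ.continuousAt_symm (χ.map_source hpχ)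
    rw [ContinuousAt, χ.left_inv hpχ] at this
    exact this.prodMk_nhds tendsto_const_nhds
  filter_upwards [hc.eventually (P.eventually_admissible hp)] with x hx
  obtain ⟨hm, hv⟩ := P.signedDivergence_snd hα s hx
  have := mvfderiv_coordField hχ hpχ hm k
  rw [hv] at this
  exact this.symm

theorem IsSigned.metricCoeff_eq {P : DualPotentials S α} {s : ℝ} (h : P.IsSigned s) (hα : 0 < α)
    {χ : OpenPartialHomeomorph M (E d)} (hχ : χ ∈ IsManifold.maximalAtlas (𝓡 d) ∞ M) {p : M}
    (hpχ : p ∈ χ.source) (hp : p ∈ P.ξ.source) (i j : Fin d) :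
    metricCoeff S.g χ i j p = - partialDeriv i (fun x => partialDeriv j
      (fun y => P.signedDivergence s (χ.symm x) (χ.symm y)) (χ p)) (χ p) := by
  rw [((P.partialDeriv_signedDivergence_eventuallyEq hα s hχ hpχ hp j).partialDeriv i).eq_of_nhds,
    partialDeriv_fun_neg, neg_neg, ← mvfderiv_coordField hχ hpχ
      ((P.contMDiffAt_sndDifferential s hp _).mdifferentiableAt two_ne_zero),
    h.mvfderiv_sndDifferential hp]
  rfl

/-- A function `h` with vanishing Hessian at `p` satisfies `X (Y h) = (∇_X Y) h` there, and the
right side is `⟨∇_X Y, v⟩` if `dh = ⟨·, v⟩`. Being coordinate-free, this applies in every chart `χ`.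
-/
theorem IsSigned.christoffelLower_eq {P : DualPotentials S α} {s : ℝ} (h : P.IsSigned s)
    (hα : 0 < α) (hd : 2 ≤ d)
    {χ : OpenPartialHomeomorph M (E d)} (hχ : χ ∈ IsManifold.maximalAtlas (𝓡 d) ∞ M) {p : M}
    (hpχ : p ∈ χ.source) (hp : p ∈ P.ξ.source) (i j k : Fin d) :
    christoffelLower S.g S.primal χ i j k p = - partialDeriv i (partialDeriv j
      (fun x => partialDeriv k
        (fun y => P.signedDivergence s (χ.symm x) (χ.symm y)) (χ p))) (χ p) := by
  have hcov := covHessian_coordField S.primal hχ hpχ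
    (P.contMDiffAt_sndDifferential s hp (coordField χ k p)) i j
  rw [h.covHessian_sndDifferential hd hp _ (mdifferentiableAt_coordField hχ hpχ j),
    h.mvfderiv_sndDifferential hp] at hcov
  rw [(((P.partialDeriv_signedDivergence_eventuallyEq hα s hχ hpχ hp k).partialDeriv
    j).partialDeriv i).eq_of_nhds, partialDeriv_fun_neg, partialDeriv_fun_neg, neg_neg]
  exact (sub_eq_zero.1 hcov.symm).symm

end DualPotentials

end InducedGeometry

/-! ### Exchanging primal and dual -/

section Duality

variable {d : ℕ} {M : Type*} [TopologicalSpace M] [ChartedSpace (E d) M] [IsManifold (𝓡 d) ∞ M]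

/-- The structure `(g, ∇*, ∇)`. -/
def DualisticStructure.swap (S : DualisticStructure d M) : DualisticStructure d M where
  g := S.g
  primal := S.dual
  dual := S.primal
  smooth_primal := S.smooth_dual
  smooth_dual := S.smooth_primal
  torsion_primal := S.torsion_dual
  torsion_dual := S.torsion_primal
  duality U hU X Y Z hX hY hZ x hx := by
    have h := S.duality U hU Y X Z hY hX hZ x hx
    rw [show (fun y => S.g.inner y (X y) (Y y)) = fun y => S.g.inner y (Y y) (X y) from
      funext fun y => S.g.symm y _ _, h, S.g.symm x (S.primal Y x (Z x)), S.g.symm x (Y x), add_comm]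

namespace DualPotentials

variable {S : DualisticStructure d M} {α : ℝ}

/-- The `α`-gradient relation solved for `Dφ`, using `1 - α Dφ · ξ = 1 / (1 + α ξ · η)`. -/
theorem fderiv_φ_eq (P : DualPotentials S α) {p : M} (hp : p ∈ P.ξ.source) (x : E d) :
    fderiv ℝ P.φ (P.ξ p) x = inner ℝ x (P.η p) / (1 + α * inner ℝ (P.ξ p) (P.η p)) := by
  have hA := P.gradient_pos p hp
  have hc := P.constraint p hp
  rw [inner_gradient_eq_fderiv] at hA
  rw [eq_div_iff hc.ne', P.inner_η hp, P.inner_η hp]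
  field_simp
  ring

/-- An envelope argument: when the Fenchel identity is differentiated in `η`, the terms from the
variation of `ξ` cancel by `fderiv_φ_eq`. -/
theorem gradient_ψ (hα : 0 < α) (P : DualPotentials S α) {p : M} (hp : p ∈ P.ξ.source) :
    gradient P.ψ (P.η p) = (1 / (1 + α * inner ℝ (P.ξ p) (P.η p))) • P.ξ p := by
  have hpη : p ∈ P.η.source := P.source_eq ▸ hp
  have hc := P.constraint p hp
  have hx : DifferentiableAt ℝ (P.ξ ∘ P.η.symm) (P.η p) := by
    rw [← mdifferentiableAt_iff_differentiableAt]
    refine MDifferentiableAt.comp (I' := 𝓡 d) (P.η p) ?_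
      ((chart_mdifferentiable P.η_mem).mdifferentiableAt_symm (P.η.map_source hpη))
    rw [P.η.left_inv hpη]
    exact (chart_mdifferentiable P.ξ_mem).mdifferentiableAt hp
  obtain ⟨L, hL⟩ := hx
  have hx0 : (P.ξ ∘ P.η.symm) (P.η p) = P.ξ p := by rw [Function.comp_apply, P.η.left_inv hpη]
  have hφ : HasFDerivAt P.φ (fderiv ℝ P.φ (P.ξ p)) ((P.ξ ∘ P.η.symm) (P.η p)) := by
    rw [hx0]
    exact ((P.contDiffAt_φ hp).differentiableAt (by simp)).hasFDerivAt
  have h1 := ((hL.inner ℝ (hasFDerivAt_id (P.η p))).const_mul α).const_add 1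
  have h2 := ((h1.log (by rw [hx0]; exact hc.ne')).const_mul (1 / α)).sub (hφ.comp _ hL)
  have heq : P.ψ =ᶠ[𝓝 (P.η p)] fun y =>
      1 / α * Real.log (1 + α * inner ℝ ((P.ξ ∘ P.η.symm) y) y) - P.φ ((P.ξ ∘ P.η.symm) y) := by
    filter_upwards [P.η.open_target.mem_nhds (P.η.map_source hpη)] with y hy
    have := P.fenchel (P.η.symm y) (P.source_eq ▸ P.η.map_target hy)
    rw [P.η.right_inv hy, logCost] at this
    rw [Function.comp_apply]
    linarith
  refine ext_inner_right ℝ fun v => ?_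
  rw [inner_gradient_eq_fderiv, (h2.congr_of_eventuallyEq heq).fderiv, real_inner_smul_left]
  simp [P.fderiv_φ_eq hp, P.η.left_inv hpη, fderivInnerCLM_apply]
  field_simp
  ring

/-- The dual potentials with the roles of primal and dual exchanged. -/
noncomputable def swap (P : DualPotentials S α) (hα : 0 < α) : DualPotentials S.swap α where
  ξ := P.η
  η := P.ξ
  φ := P.ψ
  ψ := P.φ
  ξ_mem := P.η_mem
  η_mem := P.ξ_mem
  source_eq := P.source_eq.symm
  smooth_φ := P.smooth_ψ
  smooth_ψ := P.smooth_φ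
  straight_primal := P.straight_dual
  straight_dual := P.straight_primal
  constraint p hp := by
    rw [real_inner_comm]
    exact P.constraint p (P.source_eq ▸ hp)
  fenchel p hp := by
    rw [add_comm, logCost, real_inner_comm]
    exact P.fenchel p (P.source_eq ▸ hp)
  gradient_pos p hp := by
    rw [P.source_eq] at hp
    have hc := P.constraint p hp
    rw [P.gradient_ψ hα hp, real_inner_smul_left, sub_pos, ← mul_assoc, mul_one_div,
      div_mul_eq_mul_div, div_lt_one hc]
    exact lt_one_add _
  dual_eq p hp := by
    rw [P.source_eq] at hp
    have hc := P.constraint p hp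
    rw [alphaGradient, P.gradient_ψ hα hp, real_inner_smul_left, smul_smul]
    refine (one_smul ℝ _).symm.trans (congrArg (· • P.ξ p) ?_)
    field_simp
    simp

theorem IsSigned.swap {P : DualPotentials S α} {s : ℝ} (h : P.IsSigned s) (hα : 0 < α) :
    (P.swap hα).IsSigned s where
  sign := h.sign
  metric_ξ p hp := h.metric_η p (P.source_eq ▸ hp)
  metric_η p hp := h.metric_ξ p (P.source_eq ▸ hp)

theorem signedDivergence_swap (P : DualPotentials S α) (hα : 0 < α) (s : ℝ) (q p : M) :
    (P.swap hα).signedDivergence s q p = P.signedDivergence s p q := by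
  simp only [signedDivergence, divergence, DualPotentials.swap, real_inner_comm (P.η q)]
  ring

theorem IsSigned.inducesOn {P : DualPotentials S α} {s : ℝ} (h : P.IsSigned s) (hα : 0 < α)
    (hd : 2 ≤ d) : InducesOn (P.signedDivergence s) S P.ξ.source where
  metric _ hχ _ hp i j := h.metricCoeff_eq hα hχ hp.1 hp.2 i j
  primal _ hχ _ hp i j k := h.christoffelLower_eq hα hd hχ hp.1 hp.2 i j k
  -- The primal formula for the swapped potentials, whose divergence has its arguments exchanged.
  dual _ hχ p hp i j k := by
    have hpη : p ∈ (P.swap hα).ξ.source := P.source_eq.symm ▸ hp.2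
    have := (h.swap hα).christoffelLower_eq hα hd hχ hp.1 hpη i j k
    simp only [signedDivergence_swap] at this
    exact this

theorem signedDivergence_neg_one (P : DualPotentials S α) :
    P.signedDivergence (-1) = P.divergence := by
  ext q p
  simp [signedDivergence]

theorem signedDivergence_one (P : DualPotentials S α) :
    P.signedDivergence 1 = P.divergenceNeg := by
  ext q p
  simp [signedDivergence, divergenceNeg_eq]

end DualPotentials

end Duality

/-! ### The theorem in both curvatures -/

theorem mainTheorem2 {d : ℕ} (hd : 2 ≤ d) {M : Type*} [TopologicalSpace M]
    [ChartedSpace (E d) M] [IsManifold (𝓡 d) ∞ M]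
    (S : DualisticStructure d M) {α : ℝ} (hα : 0 < α)
    (hprimal : ProjectivelyFlat S.primal) (hdual : ProjectivelyFlat S.dual) :
    (HasConstantSectionalCurvature S.g S.primal (-α) →
      HasConstantSectionalCurvature S.g S.dual (-α) →
        (∀ P P' : DualPotentials S α, P.IsConcave → P'.IsConcave →
          ∀ W : Set M, IsOpen W → IsPreconnected W → W ⊆ P.ξ.source ∩ P'.ξ.source →
            ∀ q ∈ W, ∀ p ∈ W, (P.Admissible q p ↔ P'.Admissible q p) ∧
              (P.Admissible q p → P.divergence q p = P'.divergence q p)) ∧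
        (∀ P : DualPotentials S α, P.IsConcave →
          (∀ p ∈ P.ξ.source, ∀ᶠ z : M × M in 𝓝 (p, p), P.Admissible z.1 z.2) ∧
          IsLocalDivergenceOn d P.divergence P.ξ.source ∧
          InducesOn P.divergence S P.ξ.source)) ∧
    (HasConstantSectionalCurvature S.g S.primal α →
      HasConstantSectionalCurvature S.g S.dual α →
        (∀ P P' : DualPotentials S α, P.IsConvex → P'.IsConvex →
          ∀ W : Set M, IsOpen W → IsPreconnected W → W ⊆ P.ξ.source ∩ P'.ξ.source →
            ∀ q ∈ W, ∀ p ∈ W, (P.Admissible q p ↔ P'.Admissible q p) ∧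
              (P.Admissible q p → P.divergenceNeg q p = P'.divergenceNeg q p)) ∧
        (∀ P : DualPotentials S α, P.IsConvex →
          (∀ p ∈ P.ξ.source, ∀ᶠ z : M × M in 𝓝 (p, p), P.Admissible z.1 z.2) ∧
          IsLocalDivergenceOn d P.divergenceNeg P.ξ.source ∧
          InducesOn P.divergenceNeg S P.ξ.source)) := by
  refine ⟨fun _ _ => ⟨fun P P' h h' W hW hWc hWs q hq p hp => ?_, fun P h => ⟨fun p hp => ?_, ?_, ?_⟩⟩,
    fun _ _ => ⟨fun P P' h h' W hW hWc hWs q hq p hp => ?_, fun P h => ⟨fun p hp => ?_, ?_, ?_⟩⟩⟩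
  · exact h.isSigned.divergence_unique h'.isSigned hα hd hW hWc hWs hq hp
  · exact P.eventually_admissible hp
  · exact P.signedDivergence_neg_one ▸ h.isSigned.isLocalDivergenceOn hα
  · exact P.signedDivergence_neg_one ▸ h.isSigned.inducesOn hα hd
  · rw [P.divergenceNeg_eq, P'.divergenceNeg_eq, neg_inj]
    exact h.isSigned.divergence_unique h'.isSigned hα hd hW hWc hWs hq hp
  · exact P.eventually_admissible hp
  · exact P.signedDivergence_one ▸ h.isSigned.isLocalDivergenceOn hα
  · exact P.signedDivergence_one ▸ h.isSigned.inducesOn hα hd
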